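/- Let $\lambda_1\in\mathbb C$, $\lambda_1\neq 0$, and let $U_a(X_{\rm sing}^{\rm aff})=\mathbb C[x,y]/(y^3-x(x-\lambda_1^3)^3)$ be the affine ring of the curve $y^3=x(x-\lambda_1^3)^3$. With the local coordinate $z$ at infinity, $x=z^{-3}$, $y=z^{-4}f(z)$, $f(z)=1-\lambda_1^3z^3$, expand each $F\in U_a(X_{\rm sing}^{\rm aff})$ as a Laurent series $F(z)\in\mathbb C((z))$, put $\iota(F)=z^3F(z)$, and let $U=\iota(U_a(X_{\rm sing}^{\rm aff}))\subset\mathbb C((z))$. A frame of $U$ is a basis $(X_j)_{j\ge 1}$ of $U$, $X_j=\sum_{i\in\mathbb Z}X_{i,j}z^{i+1}$, such that for some $l\ge 0$: $X_{-j,j}=1$ and $X_{i,j}=0$ $(i<-j)$ for all $j>l$, and $X_{i,j}=0$ $(i<-l)$ for all $j\le l$. Its $\tau$-function is the formal power series in $x=(x_1,x_2,\dots)$ $$\tau(x;X)=\sum_{\mu}X_\mu\, s_\mu(x),\qquad X_\mu=\det(X_{\mu_i-i,\,j})_{1\le i,j\le L}\quad(L>\max(l,\ell(\mu))),$$ where $\mu$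 runs over all partitions, $\ell(\mu)$ is the number of parts of $\mu$, $s_\mu(x)=\det(p_{\mu_i-i+j}(x))_{1\le i,j\le \ell(\mu)}$, $\sum_{n\ge0}p_n(x)t^n=\exp(\sum_{j\ge1}x_jt^j)$ and $p_n=0$ for $n<0$. For $r=0,1,2$ let $$\eta_r=\sum_{j\ge1,\ j\equiv r\bmod 3}x_j\lambda_1^j,\qquad \eta_r'=\frac{d\eta_r}{d\lambda_1}=\sum_{j\ge1,\ j\equiv r\bmod 3}j\,x_j\lambda_1^{j-1},$$ and let $$T(x)=-\frac{\sqrt3}{27}\lambda_1^{-5}e^{-3\eta_0}\Big\{2e^{\frac32(\eta_1+\eta_2)}\sin\Big(\tfrac{\sqrt3}{2}(\eta_1-\eta_2)+\tfrac{2\pi}{3}\Big)+2e^{-\frac32(\eta_1+\eta_2)}\sin\Big(\tfrac{\sqrt3}{2}(\eta_1-\eta_2)-\tfrac{2\pi}{3}\Big)-2\sin\big(\sqrt3(\eta_1-\eta_2)\big)-3\sqrt3\,\lambda_1\eta_2'\Big\}.$$ Then, as formal power series in $x_1,x_2,\dots$: 1. The sequence $f,\ z^{-1}f,\ z^3,\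 z^{-3}f^2,\ z^{-4}f^2,\ z^{-5}f^2,\dots$ is a frame of $U$ (with $l=3$), and its $\tau$-function is exactly $T(x)$. 2. For every frame $X$ of $U$ there is a constant $c\neq0$ with $\tau(x;X)=c\,T(x)$. -/

import Mathlib

open scoped MvPowerSeries.WithPiTopology

noncomputable section

namespace SatoTau

/-! ### The degenerate trigonal curve `y³ = x (x - λ³)³` and its image in `ℂ((z))` -/

/-- The ideal `J` of `ℂ[x, y]` generated by `y³ - x (x - λ³)³`; `X 0` is `x`, `X 1` is `y`. -/
def curveIdeal (lam : ℂ) : Ideal (MvPolynomial (Fin 2) ℂ) :=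
  Ideal.span {MvPolynomial.X 1 ^ 3 -
    MvPolynomial.X 0 * (MvPolynomial.X 0 - MvPolynomial.C (lam ^ 3)) ^ 3}

/-- The affine ring `ℂ[x, y] / J` of the singular curve. -/
abbrev AffineRing (lam : ℂ) : Type := MvPolynomial (Fin 2) ℂ ⧸ curveIdeal lam

/-- The expansions at infinity in the local coordinate `z`:
`x = z⁻³` and `y = z⁻⁴ (1 - λ³ z³)`. -/
def coordSeries (lam : ℂ) : Fin 2 → LaurentSeries ℂ :=
  ![HahnSeries.single (-3) 1,
    HahnSeries.single (-4) 1 * (1 - HahnSeries.single 3 (lam ^ 3))]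

theorem coordSeries_relation (lam : ℂ) :
    coordSeries lam 1 ^ 3 -
      coordSeries lam 0 * (coordSeries lam 0 - HahnSeries.C (lam ^ 3)) ^ 3 = 0 := by
  have h1 : (HahnSeries.single (-3) 1 - HahnSeries.C (lam ^ 3) : LaurentSeries ℂ) =
      HahnSeries.single (-3) 1 * (1 - HahnSeries.single 3 (lam ^ 3)) := by
    rw [mul_sub, mul_one, HahnSeries.single_mul_single, HahnSeries.C_apply]
    simp
  have h2 : (HahnSeries.single (-4) 1 : LaurentSeries ℂ) ^ 3 =
      HahnSeries.single (-3) 1 * (HahnSeries.single (-3) 1) ^ 3 := by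
    simp [HahnSeries.single_pow, HahnSeries.single_mul_single]
  simp only [coordSeries, Matrix.cons_val_zero, Matrix.cons_val_one]
  rw [h1, mul_pow, mul_pow, h2]
  ring

/-- The Laurent expansion at infinity of an element of the affine ring. -/
def expansion (lam : ℂ) : AffineRing lam →+* LaurentSeries ℂ :=
  Ideal.Quotient.lift (curveIdeal lam)
    (MvPolynomial.eval₂Hom (HahnSeries.C : ℂ →+* LaurentSeries ℂ) (coordSeries lam)) (by
      intro a ha
      have hle : curveIdeal lam ≤ RingHom.ker
          (MvPolynomial.eval₂Hom (HahnSeries.C : ℂ →+* LaurentSeries ℂ) (coordSeries lam)) := by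
        rw [curveIdeal, Ideal.span_le, Set.singleton_subset_iff, SetLike.mem_coe,
          RingHom.mem_ker]
        simpa only [map_sub, map_mul, map_pow, MvPolynomial.eval₂Hom_X',
          MvPolynomial.eval₂Hom_C] using coordSeries_relation lam
      exact RingHom.mem_ker.mp (hle ha))

theorem expansion_smul (lam c : ℂ) (F : AffineRing lam) :
    expansion lam (c • F) = c • expansion lam F := by
  obtain ⟨p, rfl⟩ := Ideal.Quotient.mk_surjective F
  have h : c • Ideal.Quotient.mk (curveIdeal lam) p =
      Ideal.Quotient.mk (curveIdeal lam) (MvPolynomial.C c * p) := by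
    rw [← MvPolynomial.smul_eq_C_mul]
    rfl
  rw [h, ← HahnSeries.C_mul_eq_smul, map_mul, map_mul]
  congr 1
  rw [expansion, Ideal.Quotient.lift_mk, MvPolynomial.coe_eval₂Hom, MvPolynomial.eval₂_C]

/-- The embedding `F ↦ z³ F(z)` of the affine ring in `ℂ((z))` (`3` is the genus of the smooth
curves that degenerate to the given one). -/
def iota (lam : ℂ) : AffineRing lam →ₗ[ℂ] LaurentSeries ℂ where
  toFun F := HahnSeries.single 3 1 * expansion lam F
  map_add' F G := by rw [map_add, mul_add]
  map_smul' c F := by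
    rw [expansion_smul, ← HahnSeries.C_mul_eq_smul, RingHom.id_apply, ← HahnSeries.C_mul_eq_smul]
    ring

/-- The subspace `ι(U_a(X_sing^aff))` of `ℂ((z))`. -/
def iotaAffineRing (lam : ℂ) : Submodule ℂ (LaurentSeries ℂ) :=
  LinearMap.range (iota lam)

/-! ### Frames, Plücker coordinates, Schur functions, `τ`-functions

Columns are numbered from `0` here, so `X j` is the `(j+1)`-st element of the frame; rows are
indexed by exponents of `z`, the row `i` of the basis `f_i = z^(i+1)` being the exponent `i + 1`. -/

/-- `X` is a basis of `U` that satisfies the normalization condition with the integer `l`: for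
`j ≥ l` the series `X j` is `z^(-j)` plus higher terms, and for `j < l` the series `X j` has no
term of exponent `< 1 - l`. -/
structure IsFrame (U : Submodule ℂ (LaurentSeries ℂ)) (l : ℕ) (X : ℕ → LaurentSeries ℂ) :
    Prop where
  linearIndependent : LinearIndependent ℂ X
  span_eq : Submodule.span ℂ (Set.range X) = U
  coeff_diag : ∀ j : ℕ, l ≤ j → (X j).coeff (-(j : ℤ)) = 1
  coeff_above : ∀ j : ℕ, l ≤ j → ∀ e : ℤ, e < -(j : ℤ) → (X j).coeff e = 0
  coeff_above_block : ∀ j : ℕ, j < l → ∀ e : ℤ, e < 1 - (l : ℤ) → (X j).coeff e = 0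

/-- The `i`-th part (counted from `0`) of a partition in decreasing order, `0` beyond its length. -/
def part {n : ℕ} (μ : Nat.Partition n) (i : ℕ) : ℕ :=
  (μ.parts.sort (· ≥ ·)).getD i 0

/-- The Plücker coordinate `X_μ = det (X_{m_i, j})`, where `m_i + 1 = μ_i - i` (`i ≥ 0`) for the
Maya diagram `m` of `μ`. The size is one at which the infinite determinant has stabilized. -/
def plucker (l : ℕ) (X : ℕ → LaurentSeries ℂ) {n : ℕ} (μ : Nat.Partition n) : ℂ :=
  Matrix.det (Matrix.of fun i j : Fin (max (l + 1) (μ.parts.card + 1)) =>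
    (X j).coeff ((part μ i : ℤ) - (i : ℤ)))

/-- The polynomials `p_n(x)` with `exp (∑_{j ≥ 1} x_j t^j) = ∑_n p_n(x) t^n`, and `p_n = 0` for
`n < 0`. -/
def elemSchur (n : ℤ) : MvPolynomial ℕ+ ℂ :=
  if 0 ≤ n then
    PowerSeries.coeff n.toNat
      ((PowerSeries.exp (MvPolynomial ℕ+ ℂ)).subst
        (PowerSeries.mk fun j => if h : 0 < j then MvPolynomial.X ⟨j, h⟩ else 0 :
          PowerSeries (MvPolynomial ℕ+ ℂ)))
  else 0

/-- The Schur function `s_μ(x) = det (p_{μ_i - i + j}(x))`. -/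
def schur {n : ℕ} (μ : Nat.Partition n) : MvPolynomial ℕ+ ℂ :=
  Matrix.det (Matrix.of fun i j : Fin μ.parts.card =>
    elemSchur ((part μ i : ℤ) - (i : ℤ) + (j : ℤ)))

/-- The formal power series `τ` in `x_1, x_2, …` is `τ(x; X) = ∑_μ X_μ s_μ(x)`, the sum over all
partitions (convergence is coefficientwise). -/
def IsTau (l : ℕ) (X : ℕ → LaurentSeries ℂ) (τ : MvPowerSeries ℕ+ ℂ) : Prop :=
  HasSum (fun μ : (Σ n : ℕ, Nat.Partition n) =>
    plucker l X μ.2 • (schur μ.2 : MvPowerSeries ℕ+ ℂ)) τ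

/-- The frame `f, z⁻¹ f, z³, z⁻³ f², z⁻⁴ f², z⁻⁵ f², …` with `f = 1 - λ³ z³`. -/
def stdFrame (lam : ℂ) : ℕ → LaurentSeries ℂ
  | 0 => 1 - HahnSeries.single 3 (lam ^ 3)
  | 1 => HahnSeries.single (-1) 1 * (1 - HahnSeries.single 3 (lam ^ 3))
  | 2 => HahnSeries.single 3 1
  | (j + 3) => HahnSeries.single (-((j : ℤ) + 3)) 1 * (1 - HahnSeries.single 3 (lam ^ 3)) ^ 2

/-! ### The explicit expression -/

/-- The formal series `∑_j a_j x_j`. -/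
def linearSeries (a : ℕ+ → ℂ) : MvPowerSeries ℕ+ ℂ :=
  fun n => ∑ j ∈ n.support, if n = Finsupp.single j 1 then a j else 0

theorem hasSum_linearSeries (a : ℕ+ → ℂ) :
    HasSum (fun j => a j • (MvPowerSeries.X j : MvPowerSeries ℕ+ ℂ)) (linearSeries a) := by
  classical
  rw [MvPowerSeries.WithPiTopology.hasSum_iff_hasSum_coeff]
  intro n
  have key : ∀ j, MvPowerSeries.coeff n (a j • (MvPowerSeries.X j : MvPowerSeries ℕ+ ℂ)) =
      if n = Finsupp.single j 1 then a j else 0 := by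
    intro j
    rw [map_smul, MvPowerSeries.coeff_X]
    split_ifs <;> simp
  simp only [key]
  refine hasSum_sum_of_ne_finset_zero ?_
  intro j hj
  rw [if_neg]
  rintro rfl
  simp at hj

/-- `η_r = ∑_{j ≡ r mod 3} x_j λ^j`, for `r = 0, 1, 2`. -/
def eta (lam : ℂ) (r : ℕ) : MvPowerSeries ℕ+ ℂ :=
  linearSeries fun j => if (j : ℕ) % 3 = r then lam ^ (j : ℕ) else 0

/-- `η_r' = dη_r/dλ = ∑_{j ≡ r mod 3} j x_j λ^(j-1)`. -/
def eta' (lam : ℂ) (r : ℕ) : MvPowerSeries ℕ+ ℂ :=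
  linearSeries fun j => if (j : ℕ) % 3 = r then (j : ℂ) * lam ^ ((j : ℕ) - 1) else 0

theorem hasDerivAt_coeff_eta (lam : ℂ) (r : ℕ) (n : ℕ+ →₀ ℕ) :
    HasDerivAt (fun t => MvPowerSeries.coeff n (eta t r))
      (MvPowerSeries.coeff n (eta' lam r)) lam := by
  change HasDerivAt (fun t => ∑ j ∈ n.support, _) (∑ j ∈ n.support, _) lam
  refine HasDerivAt.fun_sum fun j _ => ?_
  dsimp only
  split_ifs
  · simpa using hasDerivAt_pow (j : ℕ) lam
  · exact hasDerivAt_const _ _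
  · exact hasDerivAt_const _ _

/-- The exponential `exp(u₀) ∑_k (u - u₀)^k / k!` of a formal power series `u` with constant
term `u₀`. -/
def formalExp (u : MvPowerSeries ℕ+ ℂ) : MvPowerSeries ℕ+ ℂ :=
  Complex.exp (MvPowerSeries.constantCoeff u) •
    (PowerSeries.exp ℂ).subst (u - MvPowerSeries.C (MvPowerSeries.constantCoeff u))

/-- The sine `(exp(i u) - exp(-i u)) / (2 i)` of a formal power series `u`. -/
def formalSin (u : MvPowerSeries ℕ+ ℂ) : MvPowerSeries ℕ+ ℂ :=
  (1 / (2 * Complex.I)) • (formalExp (Complex.I • u) - formalExp (-(Complex.I • u)))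

/-- The explicit expression of the `τ`-function. -/
def explicitTau (lam : ℂ) : MvPowerSeries ℕ+ ℂ :=
  let s : ℂ := (Real.sqrt 3 : ℝ)
  let π : ℂ := (Real.pi : ℝ)
  let η₀ := eta lam 0
  let η₁ := eta lam 1
  let η₂ := eta lam 2
  (-(s / 27) * (lam ^ 5)⁻¹) • (formalExp (-((3 : ℂ) • η₀)) *
    ((2 : ℂ) • (formalExp ((3 / 2 : ℂ) • (η₁ + η₂)) *
        formalSin ((s / 2) • (η₁ - η₂) + MvPowerSeries.C (2 * π / 3)))
      + (2 : ℂ) • (formalExp (-((3 / 2 : ℂ) • (η₁ + η₂))) *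
        formalSin ((s / 2) • (η₁ - η₂) - MvPowerSeries.C (2 * π / 3)))
      - (2 : ℂ) • formalSin (s • (η₁ - η₂))
      - (3 * s * lam) • eta' lam 2))

end SatoTau

end

/-! Put `w = 1/z`, let `p(w) = ∑ p_n w^n = exp(∑ x_j w^j)` and `q = 1/p`. The τ-function is a limit
of finite determinants. If `M_N` is the `N × N` matrix with entries `∑_e X_{e,j} p_{e+k}`,
Cauchy–Binet expands `det M_N` into products of a minor of the frame and a minor of `(p_{e+k})`. The
second minor is a Schur function, homogeneous for the weight `∑ j m_j`, so each coefficient of `det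
M_N` is eventually that of `τ` (`coeff_det_stdMatrix`).

Multiplying `M_N` by the unipotent Toeplitz matrix of `q` leaves its determinant unchanged. All
columns of the frame from the seventh on become `w^j (w³ - λ³)²`, free of the variables `x_j`. The
determinant therefore lives on the six-dimensional quotient `ℂ[w]/((w³ - λ³)²)`, and six functionals
on this quotient reduce it to size six (`det_stdMatrix_mul_det`). In the limit its entries are
values of these functionals on `w^(-b) q(w)`. Functionals adapted to residue classes modulo 3 leave
a `3 × 3` determinant in the class sums of `λ^m q_m` and `m λ^m q_m` (`tendsto_det_stdMatrix`).

The roots of unity filter writes the class sums through `u_i = q(λω^i) = exp(-∑ (λω^i)^j x_j)`. The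
determinant becomes a combination of the products `u_i² u_j` and of one term `u_0 u_1 u_2` times a
derivative of `η_2` (`det_circulant_expansion`), and `explicitTau_eq` recognizes the sines in it.

The given sequence is a frame because its span contains `ι(1) = z³`, is generated from it by `x` and
`y`, and is stable under both (`span_stdFrame`). For another frame, the transition matrix is
unitriangular beyond a finite block, so all Plücker coordinates change by the determinant of that
block (`IsFrame.exists_plucker_eq`). -/

noncomputable section

namespace SatoTau

/-! ### Exponentials of formal power series -/

section Exponential

open MvPowerSeries

variable {σ : Type*}

/-- The chain rule for the exponential of a formal power series. -/
theorem pderiv_exp_subst {u : MvPowerSeries σ ℂ} (hu : constantCoeff u = 0) (i : σ) :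
    pderiv ℂ i ((PowerSeries.exp ℂ).subst u) =
      pderiv ℂ i u * (PowerSeries.exp ℂ).subst u := by
  classical
  have hs : PowerSeries.HasSubst u := PowerSeries.HasSubst.of_constantCoeff_zero hu
  have hlow : ∀ (m : σ →₀ ℕ) (k : ℕ), m.degree < k → coeff m (u ^ k) = 0 := by
    intro m k hk
    apply coeff_of_lt_order
    refine lt_of_lt_of_le (by exact_mod_cast hk) (le_order_pow_of_constantCoeff_eq_zero k hu)
  -- Since `u` has no constant term, `u ^ k` has order at least `k`. In degrees below `N` the
  -- exponential is thus a finite sum, which can be differentiated term by term.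
  have hco : ∀ (m : σ →₀ ℕ) (N : ℕ), m.degree < N → coeff m ((PowerSeries.exp ℂ).subst u) =
      coeff m (∑ k ∈ Finset.range N, ((k.factorial : ℂ)⁻¹) • u ^ k) := by
    intro m N hN
    rw [PowerSeries.coeff_subst hs, finsum_eq_sum_of_support_subset (s := Finset.range N), map_sum]
    · refine Finset.sum_congr rfl fun k _ => ?_
      simp [PowerSeries.coeff_exp]
    · intro k hk
      rw [Function.mem_support] at hk
      by_contra hkN
      exact hk (by rw [hlow m k (by simp at hkN; omega), smul_zero])
  ext n
  set N := n.degree + 2 with hN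
  have hd : (n + Finsupp.single i 1).degree < N := by
    simp [hN, map_add, Finsupp.degree_single]
  rw [coeff_pderiv, hco _ N hd, ← coeff_pderiv, map_sum, Finset.sum_range_succ',
    coeff_mul]
  have : ∀ k, pderiv ℂ i (((k + 1).factorial : ℂ)⁻¹ • u ^ (k + 1)) =
      pderiv ℂ i u * ((k.factorial : ℂ)⁻¹ • u ^ k) := by
    intro k
    rw [Derivation.map_smul, pderiv_pow, Nat.factorial_succ, Nat.add_sub_cancel,
      ← map_natCast (C (σ := σ) (R := ℂ)), smul_eq_C_mul, smul_eq_C_mul]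
    have h1 : ((k : ℂ) + 1) ≠ 0 := by exact_mod_cast Nat.succ_ne_zero k
    have h2 : ((k.factorial : ℕ) : ℂ) ≠ 0 := by exact_mod_cast k.factorial_ne_zero
    have h3 : (C ((((k + 1) * k.factorial : ℕ) : ℂ)⁻¹) * C (((k + 1 : ℕ) : ℂ)) :
        MvPowerSeries σ ℂ) = C ((k.factorial : ℂ)⁻¹) := by
      rw [← map_mul]
      congr 1
      push_cast
      field_simp
    rw [← h3]
    ring
  simp only [this, pow_zero, Derivation.map_smul, pderiv_one, smul_zero, add_zero]
  rw [← Finset.mul_sum, coeff_mul]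
  refine Finset.sum_congr rfl fun x hx => ?_
  congr 1
  rw [hco]
  have := Finset.HasAntidiagonal.mem_antidiagonal.mp hx
  have h2 : n.degree = x.1.degree + x.2.degree := by rw [← this, map_add]
  omega

theorem constantCoeff_exp_subst {u : MvPowerSeries σ ℂ} (hu : constantCoeff u = 0) :
    constantCoeff ((PowerSeries.exp ℂ).subst u) = 1 := by
  rw [PowerSeries.constantCoeff_subst (PowerSeries.HasSubst.of_constantCoeff_zero hu),
    finsum_eq_single _ 0]
  · simp
  · intro k hk
    simp [hu, hk]

theorem exp_subst_zero : (PowerSeries.exp ℂ).subst (0 : MvPowerSeries σ ℂ) = 1 := by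
  refine pderiv.ext (fun i => ?_) ?_
  · rw [pderiv_exp_subst (map_zero _)]; simp
  · rw [constantCoeff_exp_subst (map_zero _)]; simp

/-- By the chain rule all partial derivatives of the product vanish; a power series over `ℂ` is
determined by its partial derivatives and its constant term. -/
theorem exp_subst_mul_neg {u : MvPowerSeries σ ℂ} (hu : constantCoeff u = 0) :
    (PowerSeries.exp ℂ).subst u * (PowerSeries.exp ℂ).subst (-u) = 1 := by
  have hn : constantCoeff (-u) = 0 := by rw [map_neg, hu, neg_zero]
  refine pderiv.ext (fun i => ?_) ?_
  · rw [Derivation.leibniz, pderiv_exp_subst hu, pderiv_exp_subst hn, map_neg, pderiv_one,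
      smul_eq_mul, smul_eq_mul]
    ring
  · rw [map_mul, constantCoeff_exp_subst hu, constantCoeff_exp_subst hn, map_one, one_mul]

/-- The product `exp u · exp v · exp(-(u+v))` has zero partial derivatives and constant term 1, so
it equals 1; no binomial expansion is needed. -/
theorem exp_subst_add {u v : MvPowerSeries σ ℂ} (hu : constantCoeff u = 0)
    (hv : constantCoeff v = 0) :
    (PowerSeries.exp ℂ).subst (u + v) =
      (PowerSeries.exp ℂ).subst u * (PowerSeries.exp ℂ).subst v := by
  have hs : constantCoeff (u + v) = 0 := by rw [map_add, hu, hv, add_zero]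
  have hn : constantCoeff (-(u + v)) = 0 := by rw [map_neg, hs, neg_zero]
  have key : (PowerSeries.exp ℂ).subst u * (PowerSeries.exp ℂ).subst v *
      (PowerSeries.exp ℂ).subst (-(u + v)) = 1 := by
    refine pderiv.ext (fun i => ?_) ?_
    · simp only [Derivation.leibniz, pderiv_exp_subst hu, pderiv_exp_subst hv,
        pderiv_exp_subst hn, map_neg, map_add, pderiv_one, smul_eq_mul]
      ring
    · rw [map_mul, map_mul, constantCoeff_exp_subst hu, constantCoeff_exp_subst hv,
        constantCoeff_exp_subst hn, map_one, one_mul, one_mul]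
  calc (PowerSeries.exp ℂ).subst (u + v)
      = ((PowerSeries.exp ℂ).subst u * (PowerSeries.exp ℂ).subst v *
        (PowerSeries.exp ℂ).subst (-(u + v))) * (PowerSeries.exp ℂ).subst (u + v) := by
          rw [key, one_mul]
    _ = (PowerSeries.exp ℂ).subst u * (PowerSeries.exp ℂ).subst v *
        ((PowerSeries.exp ℂ).subst (u + v) * (PowerSeries.exp ℂ).subst (-(u + v))) := by ring
    _ = _ := by rw [exp_subst_mul_neg hs, mul_one]

end Exponential

theorem formalExp_of_constantCoeff_eq_zero {u : MvPowerSeries ℕ+ ℂ}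
    (hu : MvPowerSeries.constantCoeff u = 0) :
    formalExp u = (PowerSeries.exp ℂ).subst u := by
  simp [formalExp, hu]

theorem formalExp_add (u v : MvPowerSeries ℕ+ ℂ) :
    formalExp (u + v) = formalExp u * formalExp v := by
  have h : u + v - MvPowerSeries.C (MvPowerSeries.constantCoeff (u + v)) =
      (u - MvPowerSeries.C (MvPowerSeries.constantCoeff u)) +
        (v - MvPowerSeries.C (MvPowerSeries.constantCoeff v)) := by
    rw [map_add, map_add]; ring
  rw [formalExp, h, exp_subst_add (by simp) (by simp), map_add, Complex.exp_add, formalExp,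
    formalExp, smul_mul_smul_comm]

theorem formalExp_C (c : ℂ) : formalExp (MvPowerSeries.C c) = MvPowerSeries.C (Complex.exp c) := by
  rw [formalExp, MvPowerSeries.constantCoeff_C, sub_self, exp_subst_zero,
    MvPowerSeries.smul_eq_C_mul, mul_one]

/-! ### The polynomials `p_n` and their generating series -/

section GeneratingSeries

open PowerSeries

/-- The series `∑_{j ≥ 1} x_j t^j`. -/
def timeSeries : PowerSeries (MvPolynomial ℕ+ ℂ) :=
  PowerSeries.mk fun j => if h : 0 < j then MvPolynomial.X ⟨j, h⟩ else 0

/-- The series `exp (c ∑_{j ≥ 1} x_j t^j)`. -/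
def expSeries (c : ℂ) : PowerSeries (MvPolynomial ℕ+ ℂ) :=
  (PowerSeries.exp (MvPolynomial ℕ+ ℂ)).subst (c • timeSeries)

theorem constantCoeff_smul_timeSeries (c : ℂ) : constantCoeff (c • timeSeries) = 0 := by
  rw [← coeff_zero_eq_constantCoeff_apply, coeff_smul]
  simp [timeSeries]

theorem hasSubst_smul_timeSeries (c : ℂ) : HasSubst (c • timeSeries) :=
  HasSubst.of_constantCoeff_zero' (constantCoeff_smul_timeSeries c)

theorem derivative_expSeries (c : ℂ) :
    d⁄dX _ (expSeries c) = expSeries c * d⁄dX _ (c • timeSeries) := by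
  rw [expSeries, derivative_subst (hasSubst_smul_timeSeries c), derivative_exp]

theorem constantCoeff_expSeries (c : ℂ) : constantCoeff (expSeries c) = 1 := by
  have h := PowerSeries.constantCoeff_subst (hasSubst_smul_timeSeries c)
    (PowerSeries.exp (MvPolynomial ℕ+ ℂ))
  rw [finsum_eq_single _ 0] at h
  · refine Eq.trans h ?_
    simp
  · intro k hk
    have : MvPowerSeries.constantCoeff (c • timeSeries) = 0 := constantCoeff_smul_timeSeries c
    rw [map_pow, this, zero_pow hk, smul_zero]

theorem expSeries_mul_neg (c : ℂ) : expSeries c * expSeries (-c) = 1 := by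
  refine derivative.ext ?_ ?_
  · rw [Derivation.leibniz, derivative_expSeries, derivative_expSeries, derivative_one, neg_smul,
      map_neg, smul_eq_mul, smul_eq_mul]
    ring
  · rw [map_mul, constantCoeff_expSeries, constantCoeff_expSeries, map_one, one_mul]

/-- Coefficientwise differentiation of a power series with respect to `x_i`. -/
def coeffPderiv (i : ℕ+) (f : PowerSeries (MvPolynomial ℕ+ ℂ)) :
    PowerSeries (MvPolynomial ℕ+ ℂ) :=
  PowerSeries.mk fun n => MvPolynomial.pderiv i (coeff n f)

theorem coeffPderiv_mul (i : ℕ+) (f g : PowerSeries (MvPolynomial ℕ+ ℂ)) :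
    coeffPderiv i (f * g) = coeffPderiv i f * g + f * coeffPderiv i g := by
  ext1 n
  simp only [coeffPderiv, coeff_mk, coeff_mul, map_add, map_sum, MvPolynomial.pderiv_mul,
    Finset.sum_add_distrib]

theorem derivative_coeffPderiv (i : ℕ+) (f : PowerSeries (MvPolynomial ℕ+ ℂ)) :
    d⁄dX _ (coeffPderiv i f) = coeffPderiv i (d⁄dX _ f) := by
  ext1 n
  simp only [coeffPderiv, coeff_mk, coeff_derivative]
  rw [show ((n : MvPolynomial ℕ+ ℂ) + 1) = MvPolynomial.C ((n : ℂ) + 1) by simp,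
    mul_comm (coeff (n + 1) f), MvPolynomial.pderiv_C_mul, mul_comm]

theorem coeffPderiv_derivative_timeSeries (i : ℕ+) (c : ℂ) :
    coeffPderiv i (d⁄dX _ (c • timeSeries)) = c • d⁄dX _ (X ^ (i : ℕ)) := by
  rw [← derivative_coeffPderiv, ← Derivation.map_smul_of_tower]
  congr 1
  ext1 n
  rw [coeffPderiv, coeff_mk, coeff_smul, coeff_smul, coeff_X_pow, timeSeries, coeff_mk,
    Derivation.map_smul_of_tower]
  congr 1
  split_ifs with h1 h2 h2
  · have : (⟨n, h1⟩ : ℕ+) = i := PNat.eq h2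
    rw [this, MvPolynomial.pderiv_X_self]
  · refine MvPolynomial.pderiv_X_of_ne ?_
    rintro rfl
    exact h2 rfl
  · exact absurd (h2 ▸ i.pos) h1
  · exact map_zero _

/-- Differentiation in `x_i` commutes with differentiation in `t`. The difference `H` of the two
sides then solves the linear equation `H' = H · (c ∑ x_j t^j)'` and vanishes at `t = 0`, so `H ·
expSeries (-c)` is constant and equal to 0. -/
theorem coeffPderiv_expSeries (i : ℕ+) (c : ℂ) :
    coeffPderiv i (expSeries c) = c • (X ^ (i : ℕ) * expSeries c) := by
  set H := coeffPderiv i (expSeries c) - c • (X ^ (i : ℕ) * expSeries c) with hH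
  have hd : d⁄dX _ H = H * d⁄dX _ (c • timeSeries) := by
    rw [hH, map_sub, derivative_coeffPderiv, derivative_expSeries, coeffPderiv_mul,
      coeffPderiv_derivative_timeSeries,
      Derivation.map_smul_of_tower _ c (X ^ (i : ℕ) * expSeries c), Derivation.leibniz,
      derivative_expSeries, smul_eq_mul, smul_eq_mul, sub_mul, smul_add, smul_mul_assoc,
      mul_smul_comm, mul_assoc]
    abel
  have h0 : constantCoeff H = 0 := by
    rw [hH, map_sub, ← coeff_zero_eq_constantCoeff_apply, ← coeff_zero_eq_constantCoeff_apply,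
      coeff_smul, coeff_zero_eq_constantCoeff_apply (X ^ (i : ℕ) * expSeries c), map_mul, map_pow,
      constantCoeff_X, zero_pow i.ne_zero, zero_mul, smul_zero, sub_zero, coeffPderiv, coeff_mk,
      coeff_zero_eq_constantCoeff_apply, constantCoeff_expSeries, Derivation.map_one_eq_zero]
  have h1 : H * expSeries (-c) = 0 := by
    refine derivative.ext ?_ ?_
    · rw [Derivation.leibniz, hd, derivative_expSeries, neg_smul, map_neg, map_zero, smul_eq_mul,
        smul_eq_mul]
      ring
    · rw [map_mul, h0, zero_mul, map_zero]
  have h2 : H = 0 := by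
    calc H = H * expSeries (-c) * expSeries c := by
          rw [mul_assoc, mul_comm (expSeries (-c)), expSeries_mul_neg, mul_one]
      _ = 0 := by rw [h1, zero_mul]
  exact sub_eq_zero.mp h2

/-- The coefficients of `exp (c ∑_{j ≥ 1} x_j t^j)`. -/
def expCoeff (c : ℂ) (n : ℕ) : MvPolynomial ℕ+ ℂ := coeff n (expSeries c)

theorem expCoeff_zero (c : ℂ) : expCoeff c 0 = 1 := by
  rw [expCoeff, coeff_zero_eq_constantCoeff_apply, constantCoeff_expSeries]

theorem sum_expCoeff_mul_neg (c : ℂ) (n : ℕ) :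
    ∑ x ∈ Finset.HasAntidiagonal.antidiagonal n, expCoeff c x.1 * expCoeff (-c) x.2 =
      if n = 0 then 1 else 0 := by
  rw [← coeff_one, ← expSeries_mul_neg c, coeff_mul]
  rfl

theorem pderiv_expCoeff (i : ℕ+) (c : ℂ) (n : ℕ) :
    MvPolynomial.pderiv i (expCoeff c n) =
      if (i : ℕ) ≤ n then c • expCoeff c (n - i) else 0 := by
  have h := congrArg (coeff n) (coeffPderiv_expSeries i c)
  rw [coeffPderiv, coeff_mk, coeff_smul, coeff_X_pow_mul'] at h
  rw [expCoeff, h]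
  split_ifs
  · rfl
  · exact smul_zero _

theorem elemSchur_natCast (n : ℕ) : elemSchur (n : ℤ) = expCoeff 1 n := by
  rw [elemSchur, if_pos (Int.natCast_nonneg n), Int.toNat_natCast, expCoeff, expSeries, one_smul]
  rfl

theorem elemSchur_of_neg {n : ℤ} (h : n < 0) : elemSchur n = 0 := by
  rw [elemSchur, if_neg (not_le.mpr h)]

end GeneratingSeries

/-! ### The weight `∑_j j m_j` -/

/-- The weight of a monomial, in which `x_j` has weight `j`. -/
def wt (m : ℕ+ →₀ ℕ) : ℕ := Finsupp.weight (fun j : ℕ+ => (j : ℕ)) m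

theorem wt_add_single (m : ℕ+ →₀ ℕ) (i : ℕ+) : wt (m + Finsupp.single i 1) = wt m + i := by
  simp [wt, map_add, Finsupp.weight_single]

theorem wt_eq_sum (m : ℕ+ →₀ ℕ) : wt m = ∑ j ∈ m.support, m j * (j : ℕ) := by
  simp [wt, Finsupp.weight_apply, Finsupp.sum]

theorem coeff_add_single_expCoeff (c : ℂ) (m : ℕ+ →₀ ℕ) (i : ℕ+) (n : ℕ) :
    MvPolynomial.coeff (m + Finsupp.single i 1) (expCoeff c n) * (m i + 1) =
      if (i : ℕ) ≤ n then c * MvPolynomial.coeff m (expCoeff c (n - i)) else 0 := by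
  rw [← MvPolynomial.coeff_pderiv, pderiv_expCoeff]
  split_ifs <;> simp

theorem exists_eq_add_single {m : ℕ+ →₀ ℕ} (hm : m ≠ 0) :
    ∃ (m' : ℕ+ →₀ ℕ) (i : ℕ+), m = m' + Finsupp.single i 1 := by
  obtain ⟨i, hi⟩ := Finsupp.ne_iff.mp hm
  refine ⟨m - Finsupp.single i 1, i, (tsub_add_cancel_of_le ?_).symm⟩
  rw [Finsupp.single_le_iff]
  exact Nat.one_le_iff_ne_zero.mpr hi

/-- Setting all `x_j = 0` turns the generating series into `exp 0 = 1`. -/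
theorem coeff_zero_expCoeff (c : ℂ) (n : ℕ) :
    MvPolynomial.coeff 0 (expCoeff c n) = if n = 0 then 1 else 0 := by
  have h1 : (expSeries c).map (MvPolynomial.constantCoeff (σ := ℕ+) (R := ℂ)) = 1 := by
    rw [expSeries]
    refine (PowerSeries.map_subst (hasSubst_smul_timeSeries c)
      (h := MvPolynomial.constantCoeff (σ := ℕ+) (R := ℂ)) _).trans ?_
    have : (c • timeSeries).map (MvPolynomial.constantCoeff (σ := ℕ+) (R := ℂ)) = 0 := by
      ext n
      rw [PowerSeries.coeff_map, PowerSeries.coeff_smul, timeSeries, PowerSeries.coeff_mk]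
      split_ifs
      · have := MvPolynomial.constantCoeff_X ℂ (⟨n, ‹_›⟩ : ℕ+)
        rw [MvPolynomial.smul_eq_C_mul, map_mul]
        exact mul_eq_zero_of_right _ this
      · simp
    rw [PowerSeries.map_exp]
    refine (congrArg (fun u => PowerSeries.subst u (PowerSeries.exp ℂ)) this).trans ?_
    exact exp_subst_zero
  have h2 := congrArg (PowerSeries.coeff n) h1
  rw [PowerSeries.coeff_map, PowerSeries.coeff_one, MvPolynomial.constantCoeff_eq] at h2
  exact h2

/-- Differentiation in `x_i` lowers both the weight of the monomial and the index `n` by `i`, so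
induction on the weight ends at the constant monomial. -/
theorem coeff_expCoeff_of_wt_ne (c : ℂ) {m : ℕ+ →₀ ℕ} {n : ℕ} (h : wt m ≠ n) :
    MvPolynomial.coeff m (expCoeff c n) = 0 := by
  induction hk : wt m using Nat.strong_induction_on generalizing m n with
  | _ k ih =>
    by_cases hm : m = 0
    · subst hm
      rw [coeff_zero_expCoeff, if_neg]
      rintro rfl
      exact h (by simp [wt])
    · obtain ⟨m', i, rfl⟩ := exists_eq_add_single hm
      have hc := coeff_add_single_expCoeff c m' i n
      rw [wt_add_single] at h hk
      have hi := i.pos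
      have h0 : ((m' i : ℂ) + 1) ≠ 0 := by exact_mod_cast Nat.succ_ne_zero (m' i)
      split_ifs at hc with hin
      · rw [ih (wt m') (by omega) (by omega) rfl, mul_zero] at hc
        exact (mul_eq_zero.mp hc).resolve_right h0
      · exact (mul_eq_zero.mp hc).resolve_right h0

theorem isWeightedHomogeneous_elemSchur (n : ℕ) :
    MvPolynomial.IsWeightedHomogeneous (fun j : ℕ+ => (j : ℕ)) (elemSchur n) n := by
  intro m hm
  by_contra h
  exact hm (by rw [elemSchur_natCast]; exact coeff_expCoeff_of_wt_ne 1 h)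

/-! ### Evaluation of the generating series at a complex number -/

theorem pderiv_linearSeries (a : ℕ+ → ℂ) (i : ℕ+) :
    MvPowerSeries.pderiv ℂ i (linearSeries a) = MvPowerSeries.C (a i) := by
  classical
  ext m
  rw [MvPowerSeries.coeff_pderiv, MvPowerSeries.coeff_C]
  change (∑ j ∈ _, _) * _ = _
  by_cases hm : m = 0
  · subst hm
    rw [zero_add, if_pos rfl, Finsupp.support_single _ one_ne_zero, Finset.sum_singleton,
      if_pos rfl]
    simp
  · rw [if_neg hm, Finset.sum_eq_zero, zero_mul]
    intro j _
    rw [if_neg]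
    intro h
    apply hm
    have h1 : j = i := by
      by_contra hji
      have := DFunLike.congr_fun h i
      simp [hji] at this
    subst h1
    simpa using h

theorem constantCoeff_linearSeries (a : ℕ+ → ℂ) :
    MvPowerSeries.constantCoeff (linearSeries a) = 0 := by
  change (∑ j ∈ (0 : ℕ+ →₀ ℕ).support, if (0 : ℕ+ →₀ ℕ) = Finsupp.single j 1 then a j else 0) = 0
  simp

/-- The linear series `∑_j w^j x_j`. -/
def powSeries (w : ℂ) : MvPowerSeries ℕ+ ℂ := linearSeries fun j => w ^ (j : ℕ)

/-- The linear series `∑_j j w^j x_j`. -/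
def eulerSeries (w : ℂ) : MvPowerSeries ℕ+ ℂ := linearSeries fun j => (j : ℂ) * w ^ (j : ℕ)

/-- This makes sense of the substitution `t = w`: by homogeneity a monomial of weight `n` occurs
only in the coefficient of `t^n`. The series `F` with the prescribed coefficients satisfies `∂_i F =
c w^i F` and `F(0) = 1`, as the exponential does, and this system has only one solution. -/
theorem coeff_formalExp_smul_powSeries (c w : ℂ) (m : ℕ+ →₀ ℕ) :
    MvPowerSeries.coeff m (formalExp (c • powSeries w)) =
      w ^ wt m * MvPolynomial.coeff m (expCoeff c (wt m)) := by
  let F : MvPowerSeries ℕ+ ℂ := fun m => w ^ wt m * MvPolynomial.coeff m (expCoeff c (wt m))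
  have hF : ∀ m, MvPowerSeries.coeff m F =
    w ^ wt m * MvPolynomial.coeff m (expCoeff c (wt m)) := fun m => rfl
  have h0 : MvPowerSeries.constantCoeff (c • powSeries w) = 0 := by
    rw [MvPowerSeries.smul_eq_C_mul, map_mul, powSeries, constantCoeff_linearSeries, mul_zero]
  have h0' : MvPowerSeries.constantCoeff (-(c • powSeries w)) = 0 := by
    rw [map_neg, h0, neg_zero]
  have hd : ∀ i, MvPowerSeries.pderiv ℂ i F = MvPowerSeries.C (c * w ^ (i : ℕ)) * F := by
    intro i
    ext m
    rw [MvPowerSeries.coeff_pderiv, MvPowerSeries.coeff_C_mul, hF, hF, wt_add_single, mul_assoc,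
      coeff_add_single_expCoeff, if_pos (by omega), Nat.add_sub_cancel, pow_add]
    ring
  have hE : ∀ i, MvPowerSeries.pderiv ℂ i (c • powSeries w) =
      MvPowerSeries.C (c * w ^ (i : ℕ)) := by
    intro i
    rw [Derivation.map_smul, powSeries, pderiv_linearSeries, map_mul, MvPowerSeries.smul_eq_C_mul]
  have key : F * (PowerSeries.exp ℂ).subst (-(c • powSeries w)) = 1 := by
    refine MvPowerSeries.pderiv.ext (fun i => ?_) ?_
    · rw [Derivation.leibniz, hd, pderiv_exp_subst h0', map_neg, hE, MvPowerSeries.pderiv_one,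
        smul_eq_mul, smul_eq_mul]
      ring
    · rw [map_mul, constantCoeff_exp_subst h0', ← MvPowerSeries.coeff_zero_eq_constantCoeff_apply,
        hF]
      simp [wt, expCoeff_zero]
  have : formalExp (c • powSeries w) = F := by
    rw [formalExp_of_constantCoeff_eq_zero h0]
    calc (PowerSeries.exp ℂ).subst (c • powSeries w)
        = F * (PowerSeries.exp ℂ).subst (-(c • powSeries w)) *
          (PowerSeries.exp ℂ).subst (c • powSeries w) := by rw [key, one_mul]
      _ = F := by
          rw [mul_assoc, mul_comm ((PowerSeries.exp ℂ).subst (-(c • powSeries w))),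
            exp_subst_mul_neg h0, mul_one]
  rw [this, hF]

/-- A series of multiples of the `expCoeff c n` converges, and its coefficients are explicit. -/
theorem hasSum_smul_expCoeff (c : ℂ) (a : ℕ → ℂ) {F : MvPowerSeries ℕ+ ℂ}
    (hF : ∀ m, MvPowerSeries.coeff m F = a (wt m) * MvPolynomial.coeff m (expCoeff c (wt m))) :
    HasSum (fun n => a n • (expCoeff c n : MvPowerSeries ℕ+ ℂ)) F := by
  rw [MvPowerSeries.WithPiTopology.hasSum_iff_hasSum_coeff]
  intro m
  have : (fun n => MvPowerSeries.coeff m (a n • (expCoeff c n : MvPowerSeries ℕ+ ℂ))) =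
      fun n => a n * MvPolynomial.coeff m (expCoeff c n) := by
    funext n
    rw [map_smul, MvPolynomial.coeff_coe, smul_eq_mul]
  rw [this, hF]
  refine hasSum_single (f := fun n => a n * MvPolynomial.coeff m (expCoeff c n)) (wt m)
    fun n hn => ?_
  rw [coeff_expCoeff_of_wt_ne c hn.symm, mul_zero]

theorem hasSum_pow_smul_expCoeff (c w : ℂ) :
    HasSum (fun n => w ^ n • (expCoeff c n : MvPowerSeries ℕ+ ℂ))
      (formalExp (c • powSeries w)) :=
  hasSum_smul_expCoeff c (fun n => w ^ n) (coeff_formalExp_smul_powSeries c w)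

theorem coeff_linearSeries_mul (a : ℕ+ → ℂ) (F : MvPowerSeries ℕ+ ℂ) (m : ℕ+ →₀ ℕ) :
    MvPowerSeries.coeff m (linearSeries a * F) =
      ∑ j ∈ m.support, a j * MvPowerSeries.coeff (m - Finsupp.single j 1) F := by
  have h1 := (hasSum_linearSeries a).mul_right F
  rw [MvPowerSeries.WithPiTopology.hasSum_iff_hasSum_coeff] at h1
  refine (h1 m).unique ?_
  have h2 : ∀ j, MvPowerSeries.coeff m (a j • (MvPowerSeries.X j : MvPowerSeries ℕ+ ℂ) * F) =
      if j ∈ m.support then a j * MvPowerSeries.coeff (m - Finsupp.single j 1) F else 0 := by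
    intro j
    rw [smul_mul_assoc, map_smul, MvPowerSeries.X_def, MvPowerSeries.coeff_monomial_mul, one_mul,
      smul_ite, smul_zero, smul_eq_mul]
    simp only [Finsupp.single_le_iff, Nat.one_le_iff_ne_zero, Finsupp.mem_support_iff]
  simp only [h2]
  rw [← Finset.sum_congr rfl fun j (hj : j ∈ m.support) => if_pos hj]
  exact hasSum_sum_of_ne_finset_zero fun j hj => if_neg hj

/-- This is `w d/dw` applied to the exponential. On coefficients the factor `n` is the weight, and
Euler's operator `∑ j x_j ∂_j` multiplies `exp(c ∑ w^j x_j)` by `c ∑ j w^j x_j`. -/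
theorem hasSum_mul_pow_smul_expCoeff (c w : ℂ) :
    HasSum (fun n : ℕ => ((n : ℂ) * w ^ n) • (expCoeff c n : MvPowerSeries ℕ+ ℂ))
      (c • (eulerSeries w * formalExp (c • powSeries w))) := by
  refine hasSum_smul_expCoeff c (fun n => (n : ℂ) * w ^ n) fun m => ?_
  rw [map_smul, eulerSeries, coeff_linearSeries_mul]
  have hw : (wt m : ℂ) = ∑ j ∈ m.support, (m j : ℂ) * (j : ℕ) := by
    rw [wt_eq_sum]
    push_cast
    rfl
  rw [mul_assoc, hw, smul_eq_mul, Finset.sum_mul, Finset.mul_sum]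
  refine Finset.sum_congr rfl fun j hj => ?_
  have hle : Finsupp.single j 1 ≤ m := by
    rw [Finsupp.single_le_iff]
    exact Nat.one_le_iff_ne_zero.mpr (Finsupp.mem_support_iff.mp hj)
  set m' := m - Finsupp.single j 1 with hm'
  have hm : m = m' + Finsupp.single j 1 := (tsub_add_cancel_of_le hle).symm
  have h1 := coeff_add_single_expCoeff c m' j (wt m)
  rw [hm, wt_add_single, if_pos (by omega), Nat.add_sub_cancel] at h1
  rw [coeff_formalExp_smul_powSeries, hm, wt_add_single]
  have h2 : (((m' + Finsupp.single j 1 : ℕ+ →₀ ℕ) j : ℕ) : ℂ) = m' j + 1 := by simp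
  rw [h2, pow_add]
  linear_combination (-(j : ℂ) * w ^ wt m' * w ^ (j : ℕ)) * h1

/-! ### Pairing with the standard frame -/

/-- The sum `∑_e X_{e, j} F e` for the column `j` of the standard frame. -/
def stdPairing {V : Type*} [AddCommGroup V] [Module ℂ V] (lam : ℂ) : ℕ → (ℤ → V) → V
  | 0, F => F 0 - lam ^ 3 • F 3
  | 1, F => F (-1) - lam ^ 3 • F 2
  | 2, F => F 3
  | (j + 3), F => F (-((j : ℤ) + 3)) - (2 * lam ^ 3) • F (-(j : ℤ)) + lam ^ 6 • F (3 - (j : ℤ))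

theorem map_stdPairing {V W : Type*} [AddCommGroup V] [Module ℂ V] [AddCommGroup W] [Module ℂ W]
    (φ : V →ₗ[ℂ] W) (lam : ℂ) (j : ℕ) (F : ℤ → V) :
    φ (stdPairing lam j F) = stdPairing lam j fun e => φ (F e) := by
  match j with
  | 0 | 1 | 2 | j + 3 => simp [stdPairing]

theorem sum_stdPairing_mul {ι R : Type*} [CommRing R] [Algebra ℂ R] (s : Finset ι) (lam : ℂ)
    (j : ℕ) (F : ι → ℤ → R) (x : ι → R) :
    ∑ k ∈ s, stdPairing lam j (F k) * x k =
      stdPairing lam j fun e => ∑ k ∈ s, F k e * x k := by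
  match j with
  | 0 | 1 | 2 | j + 3 =>
    simp only [stdPairing, add_mul, sub_mul, smul_mul_assoc, Finset.sum_add_distrib,
      Finset.sum_sub_distrib, Finset.smul_sum]

theorem sum_coeff_single_smul {V : Type*} [AddCommGroup V] [Module ℂ V] (s : Finset ℤ) (a : ℤ)
    (r : ℂ) (F : ℤ → V) (h : a ∉ s → F a = 0) :
    ∑ e ∈ s, (HahnSeries.single a r : LaurentSeries ℂ).coeff e • F e = r • F a := by
  classical
  by_cases ha : a ∈ s
  · rw [Finset.sum_eq_single a]
    · rw [HahnSeries.coeff_single_same]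
    · intro b _ hb
      rw [HahnSeries.coeff_single_of_ne hb, zero_smul]
    · exact fun h' => absurd ha h'
  · rw [h ha, smul_zero, Finset.sum_eq_zero]
    intro b hb
    rw [HahnSeries.coeff_single_of_ne, zero_smul]
    rintro rfl
    exact ha hb

theorem stdFrame_zero (lam : ℂ) :
    stdFrame lam 0 = HahnSeries.single 0 1 - HahnSeries.single 3 (lam ^ 3) := rfl

theorem stdFrame_one (lam : ℂ) :
    stdFrame lam 1 = HahnSeries.single (-1) 1 - HahnSeries.single 2 (lam ^ 3) := by
  rw [stdFrame, mul_sub, mul_one, HahnSeries.single_mul_single, one_mul]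
  norm_num

theorem stdFrame_add_three (lam : ℂ) (j : ℕ) :
    stdFrame lam (j + 3) = HahnSeries.single (-((j : ℤ) + 3)) 1 -
      HahnSeries.single (-(j : ℤ)) (2 * lam ^ 3) + HahnSeries.single (3 - (j : ℤ)) (lam ^ 6) := by
  have h : (1 - HahnSeries.single 3 (lam ^ 3) : LaurentSeries ℂ) ^ 2 =
      1 - HahnSeries.single 3 (2 * lam ^ 3) + HahnSeries.single 6 (lam ^ 6) := by
    have h1 : (HahnSeries.single 3 (2 * lam ^ 3) : LaurentSeries ℂ) =
        2 * HahnSeries.single 3 (lam ^ 3) := by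
      rw [two_mul, two_mul, HahnSeries.single_add]
    have h2 : (HahnSeries.single 6 (lam ^ 6) : LaurentSeries ℂ) =
        HahnSeries.single 3 (lam ^ 3) * HahnSeries.single 3 (lam ^ 3) := by
      rw [HahnSeries.single_mul_single]
      congr 1
      ring
    rw [h1, h2]
    ring
  rw [stdFrame, h, mul_add, mul_sub, mul_one, HahnSeries.single_mul_single,
    HahnSeries.single_mul_single, one_mul, one_mul]
  congr 3 <;> ring_nf

/-- The members of the frame are Laurent polynomials with exponents at most 3, hence the bound in
the hypothesis on `F`. -/
theorem sum_coeff_stdFrame_smul {V : Type*} [AddCommGroup V] [Module ℂ V] (lam : ℂ) (j : ℕ)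
    (s : Finset ℤ) (F : ℤ → V) (h : ∀ e ≤ 3, e ∉ s → F e = 0) :
    ∑ e ∈ s, (stdFrame lam j).coeff e • F e = stdPairing lam j F := by
  match j with
  | 0 =>
    simp only [stdFrame_zero, HahnSeries.coeff_sub, sub_smul, Finset.sum_sub_distrib]
    rw [sum_coeff_single_smul s _ _ F (h _ (by norm_num)),
      sum_coeff_single_smul s _ _ F (h _ (by norm_num)), one_smul, stdPairing]
  | 1 =>
    simp only [stdFrame_one, HahnSeries.coeff_sub, sub_smul, Finset.sum_sub_distrib]
    rw [sum_coeff_single_smul s _ _ F (h _ (by norm_num)),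
      sum_coeff_single_smul s _ _ F (h _ (by norm_num)), one_smul, stdPairing]
  | 2 =>
    rw [stdFrame, sum_coeff_single_smul s _ _ F (h _ (by norm_num)), one_smul, stdPairing]
  | j + 3 =>
    simp only [stdFrame_add_three, HahnSeries.coeff_sub, HahnSeries.coeff_add, sub_smul, add_smul,
      Finset.sum_sub_distrib, Finset.sum_add_distrib]
    rw [sum_coeff_single_smul s _ _ F (h _ (by omega)),
      sum_coeff_single_smul s _ _ F (h _ (by omega)),
      sum_coeff_single_smul s _ _ F (h _ (by omega)), one_smul, stdPairing]

/-! ### The inverse of the generating series -/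

/-- The coefficients of `exp (-∑_{j ≥ 1} x_j t^j)`, extended by `0`. -/
def invSchur (n : ℤ) : MvPolynomial ℕ+ ℂ := if 0 ≤ n then expCoeff (-1) n.toNat else 0

theorem invSchur_natCast (n : ℕ) : invSchur (n : ℤ) = expCoeff (-1) n := by
  rw [invSchur, if_pos (Int.natCast_nonneg n), Int.toNat_natCast]

theorem invSchur_of_neg {n : ℤ} (h : n < 0) : invSchur n = 0 := by
  rw [invSchur, if_neg (not_le.mpr h)]

theorem sum_range_elemSchur_mul_invSchur (n : ℕ) :
    ∑ l ∈ Finset.range (n + 1), elemSchur l * invSchur ((n : ℤ) - l) = if n = 0 then 1 else 0 := by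
  rw [← sum_expCoeff_mul_neg 1 n, Finset.Nat.sum_antidiagonal_eq_sum_range_succ_mk]
  refine Finset.sum_congr rfl fun l hl => ?_
  rw [elemSchur_natCast, ← Nat.cast_sub (Finset.mem_range_succ_iff.mp hl), invSchur_natCast]

/-- The sequence `(p_{e+k})_{k ≥ 0}` is `w^(-e) p(w)` without its negative powers. Multiplication by
`q = 1/p` gives `w^(-e)` minus `q` times the omitted terms. Cutting off at `N > i` loses nothing,
because `q_{i-k} = 0` for `k > i`. -/
theorem sum_elemSchur_mul_invSchur (e : ℤ) {i N : ℕ} (hi : i < N) :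
    ∑ k ∈ Finset.range N, elemSchur (e + k) * invSchur ((i : ℤ) - k) =
      (if (i : ℤ) = -e then 1 else 0) -
        ∑ l ∈ Finset.range e.toNat, elemSchur l * invSchur ((i : ℤ) + e - l) := by
  have h1 : ∑ k ∈ Finset.range N, elemSchur (e + k) * invSchur ((i : ℤ) - k) =
      ∑ k ∈ Finset.range (i + 1), elemSchur (e + k) * invSchur ((i : ℤ) - k) := by
    refine (Finset.sum_subset (Finset.range_subset_range.mpr hi) fun k _ hk => ?_).symm
    rw [invSchur_of_neg, mul_zero]
    simp at hk
    omega
  rw [h1]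
  obtain ⟨a, rfl | rfl⟩ := e.eq_nat_or_neg
  · have h2 := sum_range_elemSchur_mul_invSchur (a + i)
    rw [add_assoc, Finset.sum_range_add] at h2
    rw [Int.toNat_natCast, eq_sub_iff_add_eq, add_comm]
    convert h2 using 2
    · refine Finset.sum_congr rfl fun l _ => ?_
      congr 2
      push_cast; ring
    · refine Finset.sum_congr rfl fun l _ => ?_
      congr 2
      push_cast; ring
    · simp; omega
  · have ht : (-(a : ℤ)).toNat = 0 := by omega
    rw [ht, Finset.sum_range_zero, sub_zero, neg_neg]
    by_cases hia : a ≤ i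
    · obtain ⟨n, rfl⟩ := Nat.exists_eq_add_of_le hia
      rw [add_assoc, Finset.sum_range_add, Finset.sum_eq_zero, zero_add]
      · convert sum_range_elemSchur_mul_invSchur n using 2
        · push_cast
          congr 2 <;> ring
        · simp
      · intro k hk
        rw [elemSchur_of_neg, zero_mul]
        have := Finset.mem_range.mp hk
        omega
    · rw [Finset.sum_eq_zero, if_neg (by omega)]
      intro k hk
      rw [elemSchur_of_neg, zero_mul]
      have := Finset.mem_range.mp hk
      omega

/-! ### The determinant of the truncated system -/

/-- The matrix `(∑_e X_{e, j} p_{e + k})` of size `N` for the standard frame. -/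
def stdMatrix (lam : ℂ) (N : ℕ) : Matrix (Fin N) (Fin N) (MvPolynomial ℕ+ ℂ) :=
  Matrix.of fun j k => stdPairing lam j fun e => elemSchur (e + (k : ℕ))

/-- The matrix of multiplication by the inverse of the generating series. -/
def invMatrix (N : ℕ) : Matrix (Fin N) (Fin N) (MvPolynomial ℕ+ ℂ) :=
  Matrix.of fun k i => invSchur (((i : ℕ) : ℤ) - (k : ℕ))

theorem det_invMatrix (N : ℕ) : (invMatrix N).det = 1 := by
  rw [Matrix.det_of_isUpperTriangular]
  · refine Finset.prod_eq_one fun i _ => ?_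
    rw [invMatrix, Matrix.of_apply, sub_self]
    exact (invSchur_natCast 0).trans (expCoeff_zero _)
  · intro k i hik
    rw [invMatrix, Matrix.of_apply, invSchur_of_neg]
    have : (i : ℕ) < (k : ℕ) := hik
    omega

/-- The row vector obtained from `p_{e + k}`, `k ≥ 0`, by the matrix `invMatrix`. -/
def reducedRow (e : ℤ) (i : ℕ) : MvPolynomial ℕ+ ℂ :=
  (if (i : ℤ) = -e then 1 else 0) -
    ∑ l ∈ Finset.range e.toNat, elemSchur l * invSchur ((i : ℤ) + e - l)

theorem stdMatrix_mul_invMatrix (lam : ℂ) (N : ℕ) (j i : Fin N) :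
    (stdMatrix lam N * invMatrix N) j i = stdPairing lam j fun e => reducedRow e i := by
  rw [Matrix.mul_apply]
  simp only [stdMatrix, invMatrix, Matrix.of_apply]
  rw [sum_stdPairing_mul]
  congr 1
  funext e
  rw [reducedRow, ← sum_elemSchur_mul_invSchur e i.2, Finset.sum_range]

theorem reducedRow_of_nonpos {e : ℤ} (he : e ≤ 0) (i : ℕ) :
    reducedRow e i = if (i : ℤ) = -e then 1 else 0 := by
  rw [reducedRow, Int.toNat_of_nonpos he, Finset.sum_range_zero, sub_zero]

/-- From the seventh column on all exponents of `z` are at most 0, where the reduced row of `e` is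
just `w^(-e)`. What remains is the polynomial `w^j (w³ - λ³)²`. -/
theorem stdPairing_reducedRow (lam : ℂ) (j i : ℕ) :
    (stdPairing lam (j + 6) fun e => reducedRow e i) =
      (if i = j + 6 then 1 else 0) - (2 * lam ^ 3) • (if i = j + 3 then 1 else 0) +
        lam ^ 6 • (if i = j then 1 else 0) := by
  change stdPairing lam ((j + 3) + 3) _ = _
  rw [stdPairing, reducedRow_of_nonpos (by omega), reducedRow_of_nonpos (by omega),
    reducedRow_of_nonpos (by omega)]
  have h1 : (i : ℤ) = -(-(((j + 3 : ℕ) : ℤ) + 3)) ↔ i = j + 6 := by omega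
  have h2 : (i : ℤ) = -(-((j + 3 : ℕ) : ℤ)) ↔ i = j + 3 := by omega
  have h3 : (i : ℤ) = -(3 - ((j + 3 : ℕ) : ℤ)) ↔ i = j := by omega
  simp only [h1, h2, h3]

/-- The pairing of the row `reducedRow e`, truncated at `N`, with a functional. -/
def truncPairing (N : ℕ) (e : ℤ) (c : ℤ → ℂ) : MvPolynomial ℕ+ ℂ :=
  ∑ i ∈ Finset.range N, c i • reducedRow e i

/-- Six functionals that annihilate the multiples of `(w³ - λ³)²` reduce the determinant of the
system to size six. -/
theorem det_stdMatrix_mul_det (lam : ℂ) (L : ℕ) (c : Fin 6 → ℤ → ℂ)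
    (hc : ∀ t (k : ℕ), c t ((k : ℤ) + 6) - 2 * lam ^ 3 * c t ((k : ℤ) + 3) +
      lam ^ 6 * c t k = 0) :
    (stdMatrix lam (6 + L)).det *
        MvPolynomial.C (Matrix.of fun i t : Fin 6 => c t ((i : ℕ) : ℤ)).det =
      (Matrix.of fun j t : Fin 6 =>
        stdPairing lam (j : ℕ) fun e => truncPairing (6 + L) e (c t)).det := by
  classical
  set R : Matrix (Fin 6 ⊕ Fin L) (Fin 6 ⊕ Fin L) (MvPolynomial ℕ+ ℂ) :=
    (stdMatrix lam (6 + L) * invMatrix (6 + L)).submatrix finSumFinEquiv finSumFinEquiv with hR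
  have hRdet : R.det = (stdMatrix lam (6 + L)).det := by
    rw [hR, Matrix.det_submatrix_equiv_self, Matrix.det_mul, det_invMatrix, mul_one]
  set C1 : Matrix (Fin 6) (Fin 6) (MvPolynomial ℕ+ ℂ) :=
    (Matrix.of fun i t : Fin 6 => c t ((i : ℕ) : ℤ)).map MvPolynomial.C with hC1
  set C2 : Matrix (Fin L) (Fin 6) (MvPolynomial ℕ+ ℂ) :=
    (Matrix.of fun (i : Fin L) (t : Fin 6) => MvPolynomial.C (c t ((6 + i : ℕ) : ℤ))) with hC2
  have hC1det : C1.det = MvPolynomial.C (Matrix.of fun i t : Fin 6 => c t ((i : ℕ) : ℤ)).det := by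
    rw [hC1, RingHom.map_det]
    rfl
  have hentry : ∀ (j : Fin 6 ⊕ Fin L) (t : Fin 6),
      ∑ i : Fin 6, R j (Sum.inl i) * C1 i t + ∑ i : Fin L, R j (Sum.inr i) * C2 i t =
        stdPairing lam (finSumFinEquiv j : Fin (6 + L)) fun e =>
          truncPairing (6 + L) e (c t) := by
    intro j t
    have h1 : ∀ e, truncPairing (6 + L) e (c t) = ∑ i : Fin (6 + L),
        reducedRow e i * MvPolynomial.C (c t ((i : ℕ) : ℤ)) := by
      intro e
      rw [truncPairing, Finset.sum_range]
      refine Finset.sum_congr rfl fun i _ => ?_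
      rw [MvPolynomial.smul_eq_C_mul, mul_comm]
    simp only [h1]
    rw [← sum_stdPairing_mul Finset.univ lam _ (fun (i : Fin (6 + L)) e => reducedRow e i)
      fun i => MvPolynomial.C (c t ((i : ℕ) : ℤ)), Fin.sum_univ_add]
    simp only [hR, Matrix.submatrix_apply, stdMatrix_mul_invMatrix, finSumFinEquiv_apply_left,
      finSumFinEquiv_apply_right, Fin.val_castAdd, Fin.val_natAdd]
    rfl
  -- Rows beyond the sixth are multiples of `(w³ - λ³)²`, which the functionals kill, so the lower
  -- left block is 0. The lower right block is lower unitriangular because the other two terms of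
  -- `w^j (w³ - λ³)²` have smaller degree than the leading one.
  have hmul : R * Matrix.fromBlocks C1 0 C2 1 = Matrix.fromBlocks
      (Matrix.of fun j t : Fin 6 =>
        stdPairing lam (j : ℕ) fun e => truncPairing (6 + L) e (c t))
      (R.submatrix Sum.inl Sum.inr) 0 (R.submatrix Sum.inr Sum.inr) := by
    ext j t : 2
    rcases t with t | t
    · rw [Matrix.mul_apply, Fintype.sum_sum_type]
      simp only [Matrix.fromBlocks_apply₁₁, Matrix.fromBlocks_apply₂₁]
      rw [hentry]
      rcases j with j | j
      · simp
      · simp only [finSumFinEquiv_apply_right, Fin.val_natAdd, Matrix.fromBlocks_apply₂₁,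
          Matrix.zero_apply]
        have h2 : ∀ e, truncPairing (6 + L) e (c t) = ∑ i ∈ Finset.range (6 + L),
            reducedRow e i * MvPolynomial.C (c t (i : ℤ)) := by
          intro e
          refine Finset.sum_congr rfl fun i _ => ?_
          rw [MvPolynomial.smul_eq_C_mul, mul_comm]
        simp only [h2]
        rw [← sum_stdPairing_mul _ lam _ (fun (i : ℕ) e => reducedRow e i)
          fun i => MvPolynomial.C (c t (i : ℤ))]
        simp only [add_comm 6, stdPairing_reducedRow, add_mul, sub_mul, Finset.sum_add_distrib,
          Finset.sum_sub_distrib, smul_mul_assoc, ite_mul, one_mul, zero_mul, ← Finset.smul_sum,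
          Finset.sum_ite_eq', Finset.mem_range]
        have hj := j.2
        rw [if_pos (by omega), if_pos (by omega), if_pos (by omega),
          ← MvPolynomial.C_mul', ← MvPolynomial.C_mul', ← map_mul, ← map_mul, ← map_sub, ← map_add]
        have := hc t j
        push_cast
        rw [this, map_zero]
    · rw [Matrix.mul_apply, Fintype.sum_sum_type]
      rcases j with j | j <;> simp [Matrix.one_apply]
  have hdet := congrArg Matrix.det hmul
  rw [Matrix.det_mul, Matrix.det_fromBlocks_zero₁₂, Matrix.det_one, mul_one, hC1det, hRdet,
    Matrix.det_fromBlocks_zero₂₁, Matrix.det_of_isLowerTriangular (R.submatrix Sum.inr Sum.inr),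
    Finset.prod_eq_one, mul_one] at hdet
  · exact hdet
  · intro i _
    simp only [hR, Matrix.submatrix_apply, stdMatrix_mul_invMatrix, finSumFinEquiv_apply_right,
      Fin.val_natAdd, add_comm 6, stdPairing_reducedRow]
    simp
  · intro i j hij
    have : (i : ℕ) < (j : ℕ) := hij
    simp only [hR, Matrix.submatrix_apply, stdMatrix_mul_invMatrix, finSumFinEquiv_apply_right,
      Fin.val_natAdd, add_comm 6, stdPairing_reducedRow]
    rw [if_neg (by omega), if_neg (by omega), if_neg (by omega)]
    simp

/-! ### The limit of the truncated determinants -/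

section Limit

open Filter Topology

local notation "ℱ" => MvPowerSeries ℕ+ ℂ

theorem coe_sum_mvPolynomial {ι : Type*} (s : Finset ι) (f : ι → MvPolynomial ℕ+ ℂ) :
    ((∑ i ∈ s, f i : MvPolynomial ℕ+ ℂ) : ℱ) = ∑ i ∈ s, (f i : ℱ) :=
  map_sum (MvPolynomial.coeToMvPowerSeries.ringHom (σ := ℕ+) (R := ℂ)) f s

theorem coe_neg_mvPolynomial (p : MvPolynomial ℕ+ ℂ) :
    ((-p : MvPolynomial ℕ+ ℂ) : ℱ) = -(p : ℱ) :=
  map_neg (MvPolynomial.coeToMvPowerSeries.ringHom (σ := ℕ+) (R := ℂ)) p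

theorem coe_det_mvPolynomial {n : ℕ} (M : Matrix (Fin n) (Fin n) (MvPolynomial ℕ+ ℂ)) :
    (M.det : ℱ) = (M.map fun p => (p : ℱ)).det :=
  RingHom.map_det (MvPolynomial.coeToMvPowerSeries.ringHom (σ := ℕ+) (R := ℂ)) M

theorem coe_stdPairing (lam : ℂ) (j : ℕ) (F : ℤ → MvPolynomial ℕ+ ℂ) :
    ((stdPairing lam j F : MvPolynomial ℕ+ ℂ) : ℱ) = stdPairing lam j fun e => (F e : ℱ) :=
  map_stdPairing (MvPolynomial.coeToMvPowerSeries.algHom (σ := ℕ+) (R := ℂ) ℂ).toLinearMap lam j F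

/-- The first six columns involve only exponents between -5 and 3, so convergence is needed only
there. -/
theorem tendsto_stdPairing {ι : Type*} {l : Filter ι} (lam : ℂ) {j : ℕ} (hj : j < 6)
    {F : ι → ℤ → ℱ} {G : ℤ → ℱ}
    (h : ∀ e : ℤ, -5 ≤ e → e ≤ 3 → Tendsto (fun i => F i e) l (𝓝 (G e))) :
    Tendsto (fun i => stdPairing lam j (F i)) l (𝓝 (stdPairing lam j G)) := by
  match j with
  | 0 | 1 =>
    simp only [stdPairing, MvPowerSeries.smul_eq_C_mul]
    exact (h _ (by norm_num) (by norm_num)).sub ((h _ (by norm_num) (by norm_num)).const_mul _)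
  | 2 => exact h _ (by norm_num) (by norm_num)
  | j + 3 =>
    simp only [stdPairing, MvPowerSeries.smul_eq_C_mul]
    exact ((h _ (by omega) (by omega)).sub ((h _ (by omega) (by omega)).const_mul _)).add
      ((h _ (by omega) (by omega)).const_mul _)

theorem tendsto_sum_smul_invSchur (c : ℤ → ℂ) (b : ℕ) {Z : ℱ}
    (hZ : HasSum (fun m : ℕ => c ((m : ℤ) - b) • (expCoeff (-1) m : ℱ)) Z) :
    Tendsto (fun N : ℕ => ((∑ i ∈ Finset.range N, c i • invSchur ((i : ℤ) + b) :
        MvPolynomial ℕ+ ℂ) : ℱ)) atTop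
      (𝓝 (Z - ∑ m ∈ Finset.range b, c ((m : ℤ) - b) • (expCoeff (-1) m : ℱ))) := by
  have h := (hZ.tendsto_sum_nat.comp (tendsto_add_atTop_nat b)).sub_const
    (∑ m ∈ Finset.range b, c ((m : ℤ) - b) • (expCoeff (-1) m : ℱ))
  refine h.congr fun N => ?_
  rw [Function.comp_apply, add_comm N b, Finset.sum_range_add, add_sub_cancel_left,
    coe_sum_mvPolynomial]
  refine Finset.sum_congr rfl fun i _ => ?_
  rw [MvPolynomial.coe_smul, add_comm (i : ℤ), ← Nat.cast_add, invSchur_natCast]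
  congr 2
  push_cast
  ring

theorem truncPairing_eq (N : ℕ) {e : ℕ} (he : 0 < e) (c : ℤ → ℂ) :
    truncPairing N e c = -∑ l ∈ Finset.range e, elemSchur l *
      ∑ i ∈ Finset.range N, c i • invSchur ((i : ℤ) + (e - l : ℕ)) := by
  simp only [truncPairing, reducedRow, Int.toNat_natCast, Finset.mul_sum]
  rw [Finset.sum_comm, ← Finset.sum_neg_distrib]
  refine Finset.sum_congr rfl fun i _ => ?_
  rw [if_neg (by omega), zero_sub, smul_neg, Finset.smul_sum]
  congr 1
  refine Finset.sum_congr rfl fun l hl => ?_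
  rw [mul_smul_comm, Nat.cast_sub (Finset.mem_range.mp hl).le, add_sub_assoc]

theorem truncPairing_neg (N : ℕ) {a : ℕ} (ha : a < N) (c : ℤ → ℂ) :
    truncPairing N (-(a : ℤ)) c = MvPolynomial.C (c a) := by
  rw [truncPairing, Finset.sum_eq_single a]
  · rw [reducedRow_of_nonpos (by omega), if_pos (by omega), MvPolynomial.smul_eq_C_mul, mul_one]
  · intro i _ hi
    rw [reducedRow_of_nonpos (by omega), if_neg (by omega), smul_zero]
  · intro h
    exact absurd (Finset.mem_range.mpr ha) h

/-- The limit of `truncPairing` in the range `-5 ≤ e ≤ 3`, in terms of the pairings `Z b` of a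
functional with `w^(-b)` times the inverse of the generating series. -/
def limPairing (c : ℤ → ℂ) (Z : ℕ → ℱ) (e : ℤ) : ℱ :=
  MvPowerSeries.C (c (-e)) - ∑ l ∈ Finset.range e.toNat, (elemSchur l : ℱ) * Z (e.toNat - l)

theorem tendsto_truncPairing (c : ℤ → ℂ) (Z : ℕ → ℱ)
    (hZ : ∀ b : ℕ, 1 ≤ b → b ≤ 3 →
      HasSum (fun m : ℕ => c ((m : ℤ) - b) • (expCoeff (-1) m : ℱ)) (Z b))
    {e : ℤ} (h1 : -5 ≤ e) (h2 : e ≤ 3) :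
    Tendsto (fun L : ℕ => (truncPairing (6 + L) e c : ℱ)) atTop (𝓝 (limPairing c Z e)) := by
  rcases le_or_gt e 0 with he | he
  · obtain ⟨a, rfl⟩ : ∃ a : ℕ, e = -(a : ℤ) := ⟨e.natAbs, by omega⟩
    have : ∀ L : ℕ, (truncPairing (6 + L) (-(a : ℤ)) c : ℱ) = limPairing c Z (-(a : ℤ)) := by
      intro L
      rw [truncPairing_neg _ (by omega), limPairing, Int.toNat_of_nonpos he, Finset.sum_range_zero,
        sub_zero, neg_neg, MvPolynomial.coe_C]
    simp only [this]
    exact tendsto_const_nhds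
  · obtain ⟨a, rfl⟩ : ∃ a : ℕ, e = (a : ℤ) := ⟨e.toNat, by omega⟩
    -- The terms with `m < a - l` missing from `Z (a - l)` recombine through `p q = 1`: their total
    -- degree is below `a`, so only degree 0 survives and gives `c (-a)`. As `a ≤ 3`, the relation
    -- is needed only in degrees 1 and 2.
    have hlim : limPairing c Z a = -∑ l ∈ Finset.range a, (elemSchur l : ℱ) *
        (Z (a - l) - ∑ m ∈ Finset.range (a - l),
          c ((m : ℤ) - (a - l : ℕ)) • (expCoeff (-1) m : ℱ)) := by
      have h01 := sum_range_elemSchur_mul_invSchur 0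
      have h11 := sum_range_elemSchur_mul_invSchur 1
      have h21 := sum_range_elemSchur_mul_invSchur 2
      have hq0 : (expCoeff (-1) 0 : ℱ) = 1 := by rw [expCoeff_zero, MvPolynomial.coe_one]
      have hp0 : (elemSchur 0 : ℱ) = 1 := by
        have := elemSchur_natCast 0
        rw [Nat.cast_zero] at this
        rw [this, expCoeff_zero, MvPolynomial.coe_one]
      have e11 : invSchur 1 = expCoeff (-1) 1 := invSchur_natCast 1
      have e12 : invSchur 2 = expCoeff (-1) 2 := invSchur_natCast 2
      have e10 : invSchur 0 = expCoeff (-1) 0 := invSchur_natCast 0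
      have h1' : (elemSchur 0 : ℱ) * (expCoeff (-1) 1 : ℱ) +
          (elemSchur 1 : ℱ) * (expCoeff (-1) 0 : ℱ) = 0 := by
        rw [← MvPolynomial.coe_mul, ← MvPolynomial.coe_mul, ← MvPolynomial.coe_add]
        simp [Finset.sum_range_succ, e11, e10] at h11
        simp [h11]
      have h2' : (elemSchur 0 : ℱ) * (expCoeff (-1) 2 : ℱ) +
          (elemSchur 1 : ℱ) * (expCoeff (-1) 1 : ℱ) +
          (elemSchur 2 : ℱ) * (expCoeff (-1) 0 : ℱ) = 0 := by
        rw [← MvPolynomial.coe_mul, ← MvPolynomial.coe_mul, ← MvPolynomial.coe_mul,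
          ← MvPolynomial.coe_add, ← MvPolynomial.coe_add]
        simp [Finset.sum_range_succ, e11, e12, e10] at h21
        simp [h21]
      rw [hp0, hq0] at h1' h2'
      have ha : a = 1 ∨ a = 2 ∨ a = 3 := by omega
      rcases ha with rfl | rfl | rfl
      · simp [limPairing, hp0, hq0, MvPowerSeries.smul_eq_C_mul]
      · simp [limPairing, Finset.sum_range_succ, hp0, hq0, MvPowerSeries.smul_eq_C_mul]
        linear_combination (-(MvPowerSeries.C (c (-1)) : ℱ)) * h1'
      · simp [limPairing, Finset.sum_range_succ, hp0, hq0, MvPowerSeries.smul_eq_C_mul]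
        linear_combination (-(MvPowerSeries.C (c (-2)) : ℱ)) * h1' -
          (MvPowerSeries.C (c (-1)) : ℱ) * h2'
    rw [hlim]
    have hN : Tendsto (fun L : ℕ => 6 + L) atTop atTop := 
      (tendsto_add_atTop_nat 6).congr fun L => add_comm L 6
    have hterm : ∀ l ∈ Finset.range a, Tendsto (fun L : ℕ => (elemSchur l : ℱ) *
        ((∑ i ∈ Finset.range (6 + L), c i • invSchur ((i : ℤ) + (a - l : ℕ)) :
          MvPolynomial ℕ+ ℂ) : ℱ)) atTop (𝓝 ((elemSchur l : ℱ) *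
        (Z (a - l) - ∑ m ∈ Finset.range (a - l),
          c ((m : ℤ) - (a - l : ℕ)) • (expCoeff (-1) m : ℱ)))) := by
      intro l hl
      have hl' := Finset.mem_range.mp hl
      exact ((tendsto_sum_smul_invSchur c (a - l)
        (hZ (a - l) (by omega) (by omega))).comp hN).const_mul _
    refine (tendsto_finsetSum _ hterm).neg.congr fun L => ?_
    rw [truncPairing_eq _ (by omega), coe_neg_mvPolynomial, coe_sum_mvPolynomial]
    simp only [MvPolynomial.coe_mul]

theorem tendsto_det_of {n : ℕ} {F : ℕ → Fin n → Fin n → ℱ} {G : Fin n → Fin n → ℱ}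
    (h : ∀ j t, Tendsto (fun L => F L j t) atTop (𝓝 (G j t))) :
    Tendsto (fun L => (Matrix.of (F L)).det) atTop (𝓝 (Matrix.of G).det) := by
  have hcont : Continuous fun M : Matrix (Fin n) (Fin n) ℱ => M.det := continuous_id.matrix_det
  have htend : Tendsto F atTop (𝓝 G) :=
    tendsto_pi_nhds.mpr fun j => tendsto_pi_nhds.mpr fun t => h j t
  exact (hcont.tendsto (Matrix.of G)).comp htend

theorem tendsto_det_stdMatrix_mul (lam : ℂ) (c : Fin 6 → ℤ → ℂ) (Z : Fin 6 → ℕ → ℱ)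
    (hc : ∀ t (k : ℤ), c t (k + 6) - 2 * lam ^ 3 * c t (k + 3) + lam ^ 6 * c t k = 0)
    (hZ : ∀ t (b : ℕ), 1 ≤ b → b ≤ 3 →
      HasSum (fun m : ℕ => c t ((m : ℤ) - b) • (expCoeff (-1) m : ℱ)) (Z t b)) :
    Tendsto (fun L : ℕ => ((stdMatrix lam (6 + L)).det : ℱ) *
        MvPowerSeries.C (Matrix.of fun i t : Fin 6 => c t ((i : ℕ) : ℤ)).det) atTop
      (𝓝 (Matrix.of fun j t : Fin 6 => stdPairing lam (j : ℕ) (limPairing (c t) (Z t))).det) := by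
  have h : ∀ L : ℕ, ((stdMatrix lam (6 + L)).det : ℱ) *
      MvPowerSeries.C (Matrix.of fun i t : Fin 6 => c t ((i : ℕ) : ℤ)).det =
      (Matrix.of fun j t : Fin 6 =>
        stdPairing lam (j : ℕ) fun e => (truncPairing (6 + L) e (c t) : ℱ)).det := by
    intro L
    rw [← MvPolynomial.coe_C, ← MvPolynomial.coe_mul,
      det_stdMatrix_mul_det lam L c fun t k => hc t k, coe_det_mvPolynomial]
    congr 1
    funext j t
    exact coe_stdPairing _ _ _
  simp only [h]
  exact tendsto_det_of fun j t => tendsto_stdPairing lam j.2 fun e h1 h2 =>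
    tendsto_truncPairing (c t) (Z t) (hZ t) h1 h2

/-- Laplace expansion along the first three rows uses columns 3, 4 and 0. The entry `-a` disappears
with column 3, and the two negative signs cancel. -/
theorem det_six_eq {R : Type*} [CommRing R] (a : R) (x y z : Fin 6 → R) :
    (Matrix.of ![![0, 0, 0, 1, 0, 0], ![0, 0, 0, 0, 1, 0], ![a, 0, 0, -a, 0, 0], x, y, z]).det =
      a * (Matrix.of ![![x 1, x 2, x 5], ![y 1, y 2, y 5], ![z 1, z 2, z 5]]).det := by
  have h6 : (Matrix.of ![![0, 0, 0, 1, 0, 0], ![0, 0, 0, 0, 1, 0], ![a, 0, 0, -a, 0, 0],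
      x, y, z]).submatrix Fin.succ (Fin.succAbove 3) =
      Matrix.of ![![0, 0, 0, 1, 0], ![a, 0, 0, 0, 0], ![x 0, x 1, x 2, x 4, x 5],
        ![y 0, y 1, y 2, y 4, y 5], ![z 0, z 1, z 2, z 4, z 5]] := by
    refine Matrix.ext fun i j => ?_
    fin_cases i <;> fin_cases j <;> rfl
  have h5 : (Matrix.of ![![0, 0, 0, 1, 0], ![a, 0, 0, 0, 0], ![x 0, x 1, x 2, x 4, x 5],
        ![y 0, y 1, y 2, y 4, y 5], ![z 0, z 1, z 2, z 4, z 5]]).submatrix Fin.succ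
        (Fin.succAbove 3) = Matrix.of ![![a, 0, 0, 0], ![x 0, x 1, x 2, x 5],
        ![y 0, y 1, y 2, y 5], ![z 0, z 1, z 2, z 5]] := by
    refine Matrix.ext fun i j => ?_
    fin_cases i <;> fin_cases j <;> rfl
  have h4 : (Matrix.of ![![a, 0, 0, 0], ![x 0, x 1, x 2, x 5],
        ![y 0, y 1, y 2, y 5], ![z 0, z 1, z 2, z 5]]).submatrix Fin.succ (Fin.succAbove 0) =
      Matrix.of ![![x 1, x 2, x 5], ![y 1, y 2, y 5], ![z 1, z 2, z 5]] := by
    refine Matrix.ext fun i j => ?_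
    fin_cases i <;> fin_cases j <;> rfl
  rw [Matrix.det_succ_row_zero, Finset.sum_eq_single 3, h6, Matrix.det_succ_row_zero,
    Finset.sum_eq_single 3, h5, Matrix.det_succ_row_zero, Finset.sum_eq_single 0, h4]
  · have e1 : (![0, 0, 0, 1, 0, 0] : Fin 6 → R) 3 = 1 := rfl
    have e2 : (![0, 0, 0, 1, 0] : Fin 5 → R) 3 = 1 := rfl
    norm_num [Matrix.of_apply, e1, e2]
  · intro j _ hj
    fin_cases j <;> first | exact absurd rfl hj | simp
  · simp
  · intro j _ hj
    fin_cases j <;> first | exact absurd rfl hj | simp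
  · simp
  · intro j _ hj
    fin_cases j <;> first | exact absurd rfl hj | simp
  · simp

/-- An upper triangular matrix `T` with diagonal `1, 1, 1, -λ⁶, -λ⁶, -λ⁶` factors out and takes all
the `p_l` with it. -/
theorem det_stdPairing_limPairing (lam : ℂ) (c : Fin 6 → ℤ → ℂ) (Z : Fin 6 → ℕ → ℱ)
    (hc : ∀ t (k : ℤ), c t (k + 6) - 2 * lam ^ 3 * c t (k + 3) + lam ^ 6 * c t k = 0) :
    (Matrix.of fun j t : Fin 6 => stdPairing lam (j : ℕ) (limPairing (c t) (Z t))).det =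
      -MvPowerSeries.C (lam ^ 18) * (Matrix.of ![
        fun t : Fin 6 => MvPowerSeries.C (c t 0 - lam ^ 3 * c t (-3)),
        fun t => MvPowerSeries.C (c t 1 - lam ^ 3 * c t (-2)),
        fun t => MvPowerSeries.C (c t (-3)), fun t => Z t 3, fun t => Z t 2, fun t => Z t 1] :
          Matrix (Fin 6) (Fin 6) ℱ).det := by
  set l3 : ℱ := MvPowerSeries.C (lam ^ 3) with hl3
  obtain ⟨p1, hp1⟩ : ∃ p : ℱ, (elemSchur 1 : ℱ) = p := ⟨_, rfl⟩
  obtain ⟨p2, hp2⟩ : ∃ p : ℱ, (elemSchur 2 : ℱ) = p := ⟨_, rfl⟩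
  have hp0 : (elemSchur 0 : ℱ) = 1 := by
    have := elemSchur_natCast 0
    rw [Nat.cast_zero] at this
    rw [this, expCoeff_zero, MvPolynomial.coe_one]
  have hm : ∀ x, (MvPowerSeries.C (lam ^ 3 * x) : ℱ) = l3 * MvPowerSeries.C x :=
    fun x => map_mul _ _ _
  have hl6 : (MvPowerSeries.C (lam ^ 6) : ℱ) = l3 ^ 2 := by rw [hl3, ← map_pow]; ring_nf
  have h2l3 : (MvPowerSeries.C (2 * lam ^ 3) : ℱ) = 2 * l3 := by rw [map_mul, map_ofNat]
  set T : Matrix (Fin 6) (Fin 6) ℱ := Matrix.of ![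
    ![1, 0, 0, l3, l3 * p1, l3 * p2], ![0, 1, 0, 0, l3, l3 * p1], ![0, 0, 1, -1, -p1, -p2],
    ![0, 0, 0, -l3 ^ 2, -l3 ^ 2 * p1, -l3 ^ 2 * p2], ![0, 0, 0, 0, -l3 ^ 2, -l3 ^ 2 * p1],
    ![0, 0, 0, 0, 0, -l3 ^ 2]] with hT
  have hTdet : T.det = -MvPowerSeries.C (lam ^ 18) := by
    rw [Matrix.det_of_isUpperTriangular]
    · simp [Fin.prod_univ_succ, hT, hl3]
      ring
    · intro i j hij
      fin_cases i <;> fin_cases j <;> first | rfl | exact absurd hij (by decide)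
  rw [← hTdet, ← Matrix.det_mul]
  congr 1
  have hcC : ∀ t (k : ℤ),
      (MvPowerSeries.C (c t (k + 6)) : ℱ) - 2 * l3 * MvPowerSeries.C (c t (k + 3))
      + l3 ^ 2 * MvPowerSeries.C (c t k) = 0 := by
    intro t k
    rw [← h2l3, ← hl6, ← map_mul, ← map_mul, ← map_sub, ← map_add, hc, map_zero]
  refine Matrix.ext fun j t => ?_
  -- The recurrence at -3, -2, -1 removes the constant terms from the rows of the frame members 3,
  -- 4, 5, leaving only combinations of the `Z t b` there.
  have e3 := hcC t (-3)
  have e2 := hcC t (-2)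
  have e1 := hcC t (-1)
  norm_num at e3 e2 e1
  rw [Matrix.mul_apply]
  fin_cases j <;>
    simp [Fin.sum_univ_succ, hT, stdPairing, limPairing, Finset.sum_range_succ,
      MvPowerSeries.smul_eq_C_mul, hp0, hp1, hp2, hl6, h2l3, hm, ← hl3, -map_pow, -map_mul]
  · ring
  · ring
  · ring
  · linear_combination e3
  · linear_combination e2
  · linear_combination e1

end Limit

/-! ### Functionals on `ℂ[w]/((w³ - λ³)²)` sorted by residue class modulo 3. -/

section ClassFunctionals

open Filter Topology

local notation "ℱ" => MvPowerSeries ℕ+ ℂ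

/-- The functional `w^k ↦ λ^(k - r)` on the residue class `r` modulo `3`. -/
def classFun (lam : ℂ) (r k : ℤ) : ℂ := if k % 3 = r then lam ^ (k - r) else 0

/-- The functional `w^k ↦ (k - r) / 3 * λ^(k - r)` on the residue class `r` modulo `3`. -/
def classDer (lam : ℂ) (r k : ℤ) : ℂ :=
  if k % 3 = r then (((k - r : ℤ) : ℂ) / 3) * lam ^ (k - r) else 0

theorem classFun_recurrence {lam : ℂ} (hlam : lam ≠ 0) (r k : ℤ) :
    classFun lam r (k + 6) - 2 * lam ^ 3 * classFun lam r (k + 3) + lam ^ 6 * classFun lam r k =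
      0 := by
  rw [classFun, classFun, classFun, show (k + 6) % 3 = k % 3 by omega,
    show (k + 3) % 3 = k % 3 by omega]
  split_ifs
  · rw [show k + 6 - r = (k - r) + (6 : ℕ) by push_cast; ring,
      show k + 3 - r = (k - r) + (3 : ℕ) by push_cast; ring, zpow_add₀ hlam, zpow_add₀ hlam,
      zpow_natCast, zpow_natCast]
    ring
  · ring

theorem classDer_recurrence {lam : ℂ} (hlam : lam ≠ 0) (r k : ℤ) :
    classDer lam r (k + 6) - 2 * lam ^ 3 * classDer lam r (k + 3) + lam ^ 6 * classDer lam r k =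
      0 := by
  rw [classDer, classDer, classDer, show (k + 6) % 3 = k % 3 by omega,
    show (k + 3) % 3 = k % 3 by omega]
  split_ifs
  · rw [show k + 6 - r = (k - r) + (6 : ℕ) by push_cast; ring,
      show k + 3 - r = (k - r) + (3 : ℕ) by push_cast; ring, zpow_add₀ hlam, zpow_add₀ hlam,
      zpow_natCast, zpow_natCast]
    push_cast
    ring
  · ring

/-- Division by `w^b` only moves the residue class from `r` to `r + b`. Every value on `w^(-b) q(w)`
is therefore a power of `λ` times one of three class sums. -/
theorem classFun_sub {lam : ℂ} (hlam : lam ≠ 0) {r : ℕ} (hr : r < 3) (m b : ℕ) :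
    classFun lam r ((m : ℤ) - b) =
      (lam ^ (r + b))⁻¹ * (if m % 3 = (r + b) % 3 then lam ^ m else 0) := by
  rw [classFun]
  by_cases h : m % 3 = (r + b) % 3
  · rw [if_pos (by omega), if_pos h, show (m : ℤ) - b - r = (m : ℤ) - ((r + b : ℕ) : ℤ) by
      push_cast; ring, zpow_sub₀ hlam, zpow_natCast, zpow_natCast, div_eq_inv_mul]
  · rw [if_neg (by omega), if_neg h, mul_zero]

theorem classDer_sub {lam : ℂ} (hlam : lam ≠ 0) {r : ℕ} (hr : r < 3) (m b : ℕ) :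
    classDer lam r ((m : ℤ) - b) =
      (lam ^ (r + b))⁻¹ / 3 * (if m % 3 = (r + b) % 3 then (m : ℂ) * lam ^ m else 0) -
        (lam ^ (r + b))⁻¹ / 3 * (r + b : ℕ) *
          (if m % 3 = (r + b) % 3 then lam ^ m else 0) := by
  rw [classDer]
  by_cases h : m % 3 = (r + b) % 3
  · rw [if_pos (by omega), if_pos h, if_pos h,
      show (m : ℤ) - b - r = (m : ℤ) - ((r + b : ℕ) : ℤ) by push_cast; ring, zpow_sub₀ hlam,
      zpow_natCast, zpow_natCast, div_eq_inv_mul]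
    push_cast
    ring
  · rw [if_neg (by omega), if_neg h, if_neg h]
    ring

/-- The six functionals dual to `w^k`, `0 ≤ k < 6`, up to a triangular change of basis. -/
def classFunctionals (lam : ℂ) : Fin 6 → ℤ → ℂ :=
  ![classFun lam 0, classFun lam 1, classFun lam 2, classDer lam 0, classDer lam 1, classDer lam 2]

theorem classFunctionals_recurrence {lam : ℂ} (hlam : lam ≠ 0) (t : Fin 6) (k : ℤ) :
    classFunctionals lam t (k + 6) - 2 * lam ^ 3 * classFunctionals lam t (k + 3) +
      lam ^ 6 * classFunctionals lam t k = 0 := by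
  fin_cases t
  · exact classFun_recurrence hlam 0 k
  · exact classFun_recurrence hlam 1 k
  · exact classFun_recurrence hlam 2 k
  · exact classDer_recurrence hlam 0 k
  · exact classDer_recurrence hlam 1 k
  · exact classDer_recurrence hlam 2 k

theorem det_classFunctionals (lam : ℂ) :
    (Matrix.of fun i t : Fin 6 => classFunctionals lam t ((i : ℕ) : ℤ)).det = lam ^ 9 := by
  rw [Matrix.det_of_isLowerTriangular]
  · have h3 : lam ^ (3 : ℤ) = lam ^ 3 := by norm_cast
    have h : ∀ i : Fin 6, classFunctionals lam i ((i : ℕ) : ℤ) =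
        (![1, 1, 1, lam ^ 3, lam ^ 3, lam ^ 3] : Fin 6 → ℂ) i := by
      intro i
      fin_cases i <;> norm_num [classFunctionals, classFun, classDer, h3]
    simp only [Matrix.of_apply, h]
    rw [Fin.prod_univ_six]
    simp only [Matrix.cons_val]
    ring
  · intro i j hij
    have hij' : i < j := hij
    fin_cases i <;> fin_cases j <;>
      first
      | exact absurd hij' (by decide)
      | norm_num [classFunctionals, classFun, classDer]

/-- The three constant rows of the `6 × 6` determinant are supported on the functionals 0, 3 and 4,
so the functionals 1, 2 and 5 remain. The powers of `λ` are `λ^18` from the triangular factor,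
`λ^(-3)` from the constant rows, `λ^(-11)` from the shifts and `λ^(-9)` from `det_classFunctionals`,
in all `λ^(-5)`. The factor `1/3` comes from `classDer`. -/
theorem tendsto_det_stdMatrix {lam : ℂ} (hlam : lam ≠ 0) (U Y : ℕ → ℱ)
    (hU : ∀ s < 3, HasSum (fun m : ℕ => (if m % 3 = s then lam ^ m else 0) •
      (expCoeff (-1) m : ℱ)) (U s))
    (hY : ∀ s < 3, HasSum (fun m : ℕ => (if m % 3 = s then (m : ℂ) * lam ^ m else 0) •
      (expCoeff (-1) m : ℱ)) (Y s)) :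
    Tendsto (fun L : ℕ => ((stdMatrix lam (6 + L)).det : ℱ)) atTop
      (𝓝 (-MvPowerSeries.C ((lam ^ 5)⁻¹ / 3) * (Matrix.of ![
        ![U 1, U 2, Y 2 - 5 * U 2], ![U 0, U 1, Y 1 - 4 * U 1],
        ![U 2, U 0, Y 0 - 3 * U 0]]).det)) := by
  set c := classFunctionals lam with hc
  let Z : Fin 6 → ℕ → ℱ := fun t b m =>
    c t ((wt m : ℤ) - b) * MvPolynomial.coeff m (expCoeff (-1) (wt m))
  have hZ : ∀ t (b : ℕ), HasSum (fun m : ℕ => c t ((m : ℤ) - b) • (expCoeff (-1) m : ℱ)) (Z t b) :=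
    fun t b => hasSum_smul_expCoeff (-1) (fun n : ℕ => c t ((n : ℤ) - b)) fun m => rfl
  have hfun : ∀ (t : Fin 6) (r b : ℕ), r < 3 → c t = classFun lam r →
      Z t b = MvPowerSeries.C ((lam ^ (r + b))⁻¹) * U ((r + b) % 3) := by
    intro t r b hr ht
    refine (hZ t b).unique ?_
    have h := (hU ((r + b) % 3) (Nat.mod_lt _ (by norm_num))).mul_left
      (MvPowerSeries.C ((lam ^ (r + b))⁻¹))
    have he : (fun m : ℕ => c t ((m : ℤ) - b) • (expCoeff (-1) m : ℱ)) = fun m =>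
        MvPowerSeries.C ((lam ^ (r + b))⁻¹) *
          ((if m % 3 = (r + b) % 3 then lam ^ m else 0) • (expCoeff (-1) m : ℱ)) := by
      funext m
      rw [ht, classFun_sub hlam hr, MvPowerSeries.smul_eq_C_mul, map_mul, mul_assoc,
        MvPowerSeries.smul_eq_C_mul]
    rw [he]
    exact h
  have hder : ∀ b : ℕ, Z 5 b = MvPowerSeries.C ((lam ^ (2 + b))⁻¹ / 3) *
      (Y ((2 + b) % 3) - MvPowerSeries.C ((2 + b : ℕ) : ℂ) * U ((2 + b) % 3)) := by
    intro b
    refine (hZ 5 b).unique ?_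
    have := ((hY ((2 + b) % 3) (Nat.mod_lt _ (by norm_num))).sub
      ((hU ((2 + b) % 3) (Nat.mod_lt _ (by norm_num))).mul_left
        (MvPowerSeries.C ((2 + b : ℕ) : ℂ)))).mul_left (MvPowerSeries.C ((lam ^ (2 + b))⁻¹ / 3))
    have he : (fun m : ℕ => c 5 ((m : ℤ) - b) • (expCoeff (-1) m : ℱ)) = fun m =>
        MvPowerSeries.C ((lam ^ (2 + b))⁻¹ / 3) *
          ((if m % 3 = (2 + b) % 3 then (m : ℂ) * lam ^ m else 0) • (expCoeff (-1) m : ℱ) -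
            MvPowerSeries.C ((2 + b : ℕ) : ℂ) *
              ((if m % 3 = (2 + b) % 3 then lam ^ m else 0) • (expCoeff (-1) m : ℱ))) := by
      funext m
      have h5 : c 5 = classDer lam (2 : ℕ) := rfl
      rw [h5, classDer_sub hlam (by norm_num)]
      simp only [MvPowerSeries.smul_eq_C_mul, map_sub, map_mul]
      ring
    rw [he]
    exact this
  have hrec := classFunctionals_recurrence hlam
  have hlim := tendsto_det_stdMatrix_mul lam c Z hrec fun t b _ _ => hZ t b
  rw [det_stdPairing_limPairing lam c Z hrec, det_classFunctionals] at hlim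
  have hmat : (Matrix.of ![
        fun t : Fin 6 => MvPowerSeries.C (c t 0 - lam ^ 3 * c t (-3)),
        fun t => MvPowerSeries.C (c t 1 - lam ^ 3 * c t (-2)),
        fun t => MvPowerSeries.C (c t (-3)), fun t => Z t 3, fun t => Z t 2, fun t => Z t 1] :
          Matrix (Fin 6) (Fin 6) ℱ) = Matrix.of ![![0, 0, 0, 1, 0, 0], ![0, 0, 0, 0, 1, 0],
          ![MvPowerSeries.C ((lam ^ 3)⁻¹), 0, 0, -MvPowerSeries.C ((lam ^ 3)⁻¹), 0, 0],
          fun t => Z t 3, fun t => Z t 2, fun t => Z t 1] := by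
    have hl : lam ^ (-3 : ℤ) = (lam ^ 3)⁻¹ := by
      rw [zpow_neg]; norm_cast
    refine Matrix.ext fun i t => ?_
    have h0 : c t 0 - lam ^ 3 * c t (-3) = (![0, 0, 0, 1, 0, 0] : Fin 6 → ℂ) t := by
      fin_cases t <;> norm_num [hc, classFunctionals, classFun, classDer, hl, hlam]
    have h1 : c t 1 - lam ^ 3 * c t (-2) = (![0, 0, 0, 0, 1, 0] : Fin 6 → ℂ) t := by
      fin_cases t <;> norm_num [hc, classFunctionals, classFun, classDer, hl, hlam]
    have h2 : c t (-3) = (![(lam ^ 3)⁻¹, 0, 0, -(lam ^ 3)⁻¹, 0, 0] : Fin 6 → ℂ) t := by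
      fin_cases t <;> norm_num [hc, classFunctionals, classFun, classDer, hl, hlam]
    fin_cases i
    · change MvPowerSeries.C (c t 0 - lam ^ 3 * c t (-3)) = _
      rw [h0]
      fin_cases t <;> simp
    · change MvPowerSeries.C (c t 1 - lam ^ 3 * c t (-2)) = _
      rw [h1]
      fin_cases t <;> simp
    · change MvPowerSeries.C (c t (-3)) = _
      rw [h2]
      fin_cases t <;> simp
    · rfl
    · rfl
    · rfl
  rw [hmat, det_six_eq] at hlim
  have hlim' := hlim.mul_const (MvPowerSeries.C ((lam ^ 9)⁻¹) : ℱ)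
  have hz1 : ∀ b, Z 1 b = MvPowerSeries.C ((lam ^ (1 + b))⁻¹) * U ((1 + b) % 3) :=
    fun b => hfun 1 1 b (by norm_num) rfl
  have hz2 : ∀ b, Z 2 b = MvPowerSeries.C ((lam ^ (2 + b))⁻¹) * U ((2 + b) % 3) :=
    fun b => hfun 2 2 b (by norm_num) rfl
  have hone : (MvPowerSeries.C (lam ^ 9) : ℱ) * MvPowerSeries.C ((lam ^ 9)⁻¹) = 1 := by
    rw [← map_mul, mul_inv_cancel₀ (pow_ne_zero _ hlam), map_one]
  convert hlim' using 2
  · rw [mul_assoc, hone, mul_one]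
  · rw [Matrix.det_fin_three, Matrix.det_fin_three]
    simp only [Matrix.of_apply, Matrix.cons_val, hz1, hz2, hder, div_eq_mul_inv, ← inv_pow,
      map_mul, map_pow]
    norm_num
    rw [show (MvPowerSeries.C 3 : ℱ) = 3 from map_ofNat _ 3,
      show (MvPowerSeries.C 4 : ℱ) = 4 from map_ofNat _ 4,
      show (MvPowerSeries.C 5 : ℱ) = 5 from map_ofNat _ 5]
    have hli : (MvPowerSeries.C lam : ℱ) ^ 18 * MvPowerSeries.C lam⁻¹ ^ 18 = 1 := by
      rw [← mul_pow, ← map_mul, mul_inv_cancel₀ hlam, map_one, one_pow]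
    linear_combination -((MvPowerSeries.C lam⁻¹ : ℱ) ^ 5 * MvPowerSeries.C (1 / 3) *
      (U 1 * U 1 * (Y 0 - 3 * U 0) - U 1 * (Y 1 - 4 * U 1) * U 0 - U 2 * U 0 * (Y 0 - 3 * U 0) +
            U 2 * (Y 1 - 4 * U 1) * U 2 +
          (Y 2 - 5 * U 2) * U 0 * U 0 -
        (Y 2 - 5 * U 2) * U 1 * U 2)) * hli

end ClassFunctionals

/-! ### Evaluation at the cube roots of `λ³` and the explicit expression -/

section Explicit

open Filter Topology

local notation "ℱ" => MvPowerSeries ℕ+ ℂ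

/-- In the last column `k0` multiplies a copy of the second column and `k1` a copy of the first, so
both drop out. The coefficient of `k2` is a circulant determinant with eigenvalues `3a`, `3b`, `3c`,
hence the term in `a b c`. The multiples 5, 4, 3 of the `V`'s give the remaining products. -/
theorem det_circulant_expansion {R : Type*} [CommRing R] {W : R} (h : W ^ 2 + W + 1 = 0)
    (a b c k0 k1 k2 : R) {V0 V1 V2 Y0 Y1 Y2 v0 v1 v2 : R} (hV0 : V0 = a + b + c)
    (hV1 : V1 = a + W ^ 2 * b + W * c) (hV2 : V2 = a + W * b + W ^ 2 * c)
    (h0 : v0 = -((k0 + k1 + k2) * a)) (h1 : v1 = -((k0 + W * k1 + W ^ 2 * k2) * b))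
    (h2 : v2 = -((k0 + W ^ 2 * k1 + W * k2) * c)) (hY0 : Y0 = v0 + v1 + v2)
    (hY1 : Y1 = v0 + W ^ 2 * v1 + W * v2) (hY2 : Y2 = v0 + W * v1 + W ^ 2 * v2) :
    -(Matrix.of ![![V1, V2, Y2 - 5 * V2], ![V0, V1, Y1 - 4 * V1], ![V2, V0, Y0 - 3 * V0]]).det =
      3 * ((2 * W + 1) * (W * (c ^ 2 * b) - W ^ 2 * (b ^ 2 * c) + W ^ 2 * (a ^ 2 * c) -
        W * (a ^ 2 * b) - c ^ 2 * a + b ^ 2 * a) + 9 * k2 * (a * b * c)) := by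
  subst hV0 hV1 hV2 hY0 hY1 hY2 h0 h1 h2
  have h3 : W ^ 3 = 1 := by linear_combination (W - 1) * h
  have h4 : W ^ 4 = W := by linear_combination W * h3
  have h5 : W ^ 5 = -1 - W := by linear_combination W ^ 2 * h3 + h
  have h6 : W ^ 6 = 1 := by linear_combination (W ^ 3 + 1) * h3
  have h7 : W ^ 7 = W := by linear_combination W * h6
  have h8 : W ^ 8 = -1 - W := by linear_combination W ^ 2 * h6 + h
  have h2 : W ^ 2 = -1 - W := by linear_combination h
  rw [Matrix.det_fin_three]
  simp only [Matrix.of_apply, Matrix.cons_val]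
  ring_nf
  simp only [h2, h3, h4, h5, h6, h7, h8]
  ring

/-- The primitive cube root of unity `(-1 + √3 i) / 2`. -/
def omega : ℂ := (-1 + ((Real.sqrt 3 : ℝ) : ℂ) * Complex.I) / 2

theorem sqrt_three_sq : (((Real.sqrt 3 : ℝ) : ℂ)) ^ 2 = 3 := by
  rw [← Complex.ofReal_pow, Real.sq_sqrt (by norm_num)]
  norm_num

theorem omega_sq : omega ^ 2 = (-1 - ((Real.sqrt 3 : ℝ) : ℂ) * Complex.I) / 2 := by
  rw [omega]
  linear_combination (1 / 4) * Complex.I ^ 2 * sqrt_three_sq + (3 / 4) * Complex.I_sq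

theorem omega_relation : omega ^ 2 + omega + 1 = 0 := by
  rw [omega_sq, omega]
  ring

theorem omega_cube : omega ^ 3 = 1 := by
  linear_combination (omega - 1) * omega_relation

theorem exp_two_pi_div_three_mul_I :
    Complex.exp (Complex.I * (2 * ((Real.pi : ℝ) : ℂ) / 3)) = omega := by
  have h : Complex.I * (2 * ((Real.pi : ℝ) : ℂ) / 3) =
      (((2 * Real.pi / 3 : ℝ)) : ℂ) * Complex.I := by
    push_cast
    ring
  have e : 2 * Real.pi / 3 = Real.pi - Real.pi / 3 := by ring
  rw [h, Complex.exp_mul_I, ← Complex.ofReal_cos, ← Complex.ofReal_sin, e, Real.cos_pi_sub,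
    Real.sin_pi_sub, Real.cos_pi_div_three, Real.sin_pi_div_three, omega]
  push_cast
  ring

theorem exp_neg_two_pi_div_three_mul_I :
    Complex.exp (-(Complex.I * (2 * ((Real.pi : ℝ) : ℂ) / 3))) = omega ^ 2 := by
  rw [Complex.exp_neg, exp_two_pi_div_three_mul_I]
  refine inv_eq_of_mul_eq_one_right ?_
  rw [← omega_cube]
  ring

/-- The roots of unity filter: `ω^(2s)` and `ω^s` are the inverses of `ω^s` and `ω^(2s)`. -/
theorem indicator_mod_three (lam : ℂ) (m : ℕ) {s : ℕ} (hs : s < 3) :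
    (if m % 3 = s then lam ^ m else 0) = 1 / 3 * (lam ^ m + omega ^ (2 * s) * (lam * omega) ^ m +
      omega ^ s * (lam * omega ^ 2) ^ m) := by
  have h1 : omega ^ m = omega ^ (m % 3) := by
    conv_lhs => rw [← Nat.div_add_mod m 3]
    rw [pow_add, pow_mul, omega_cube, one_pow, one_mul]
  rw [mul_pow, mul_pow, show (omega ^ 2) ^ m = (omega ^ m) ^ 2 by
    rw [← pow_mul, ← pow_mul, mul_comm], h1]
  have hm : m % 3 < 3 := Nat.mod_lt _ (by norm_num)
  have h2 : omega ^ 2 = -1 - omega := by linear_combination omega_relation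
  have h3 := omega_cube
  have h4 : omega ^ 4 = omega := by linear_combination omega * h3
  have h5 : omega ^ 5 = -1 - omega := by linear_combination omega ^ 2 * h3 + h2
  have h6 : omega ^ 6 = 1 := by linear_combination (omega ^ 3 + 1) * h3
  have key : (if m % 3 = s then (1 : ℂ) else 0) = 1 / 3 * (1 + omega ^ (2 * s) * omega ^ (m % 3) +
      omega ^ s * (omega ^ (m % 3)) ^ 2) := by
    generalize m % 3 = r at hm
    rw [← pow_mul, ← pow_add, ← pow_add]
    interval_cases r <;> interval_cases s <;> norm_num [h2, h3, h4, h5, h6] <;> ring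
  rw [show (if m % 3 = s then lam ^ m else 0) = lam ^ m * (if m % 3 = s then (1 : ℂ) else 0) by
    split_ifs <;> simp, key]
  ring

theorem linearSeries_combination (x y z : ℂ) (a b c : ℕ+ → ℂ) :
    linearSeries (fun j => x * a j + y * b j + z * c j) =
      x • linearSeries a + y • linearSeries b + z • linearSeries c := by
  ext m
  rw [map_add, map_add, map_smul, map_smul, map_smul]
  change ∑ j ∈ m.support, _ = x * (∑ j ∈ m.support, _) + y * (∑ j ∈ m.support, _) +
    z * (∑ j ∈ m.support, _)
  rw [Finset.mul_sum, Finset.mul_sum, Finset.mul_sum, ← Finset.sum_add_distrib,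
    ← Finset.sum_add_distrib]
  refine Finset.sum_congr rfl fun j _ => ?_
  dsimp only
  split_ifs <;> ring

/-- A series over all indices, split into residue classes modulo `3` with a cube root of unity. -/
theorem linearSeries_split {w : ℂ} (hw : w ^ 3 = 1) (f : ℕ+ → ℂ) :
    linearSeries (fun j => w ^ (j : ℕ) * f j) =
      linearSeries (fun j => if (j : ℕ) % 3 = 0 then f j else 0) +
        w • linearSeries (fun j => if (j : ℕ) % 3 = 1 then f j else 0) +
        w ^ 2 • linearSeries (fun j => if (j : ℕ) % 3 = 2 then f j else 0) := by
  rw [← one_smul ℂ (linearSeries fun j => if (j : ℕ) % 3 = 0 then f j else 0),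
    ← linearSeries_combination]
  congr 1
  funext j
  have h1 : w ^ (j : ℕ) = w ^ ((j : ℕ) % 3) := by
    conv_lhs => rw [← Nat.div_add_mod (j : ℕ) 3]
    rw [pow_add, pow_mul, hw, one_pow, one_mul]
  rw [h1]
  have hm : (j : ℕ) % 3 < 3 := Nat.mod_lt _ (by norm_num)
  generalize (j : ℕ) % 3 = r at hm
  interval_cases r <;> simp

theorem powSeries_mul {w : ℂ} (hw : w ^ 3 = 1) (lam : ℂ) :
    powSeries (lam * w) = eta lam 0 + w • eta lam 1 + w ^ 2 • eta lam 2 := by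
  rw [eta, eta, eta, ← linearSeries_split hw fun j => lam ^ (j : ℕ), powSeries]
  congr 1
  funext j
  rw [mul_pow, mul_comm]

/-- The series `∑_{j ≡ r mod 3} j x_j λ^j`. -/
def eulerClass (lam : ℂ) (r : ℕ) : ℱ :=
  linearSeries fun j => if (j : ℕ) % 3 = r then (j : ℂ) * lam ^ (j : ℕ) else 0

theorem eulerSeries_mul {w : ℂ} (hw : w ^ 3 = 1) (lam : ℂ) :
    eulerSeries (lam * w) =
      eulerClass lam 0 + w • eulerClass lam 1 + w ^ 2 • eulerClass lam 2 := by
  rw [eulerClass, eulerClass, eulerClass,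
    ← linearSeries_split hw fun j => (j : ℂ) * lam ^ (j : ℕ), eulerSeries]
  congr 1
  funext j
  rw [mul_pow]
  ring

theorem eulerClass_eq (lam : ℂ) (r : ℕ) : eulerClass lam r = lam • eta' lam r := by
  have h := linearSeries_combination lam 0 0
    (fun j => if (j : ℕ) % 3 = r then (j : ℂ) * lam ^ ((j : ℕ) - 1) else 0) 0 0
  rw [zero_smul, add_zero, add_zero] at h
  rw [eta', ← h, eulerClass]
  congr 1
  funext j
  split_ifs
  · obtain ⟨n, hn⟩ : ∃ n, (j : ℕ) = n + 1 := ⟨(j : ℕ) - 1, (Nat.sub_add_cancel j.pos).symm⟩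
    rw [hn, Nat.add_sub_cancel, pow_succ]
    push_cast
    ring
  · simp

/-- The inverse of the generating series at `λ ω^i`. -/
def invValue (lam : ℂ) (i : ℕ) : ℱ := formalExp ((-1 : ℂ) • powSeries (lam * omega ^ i))

theorem omega_pow_cube (i : ℕ) : (omega ^ i) ^ 3 = 1 := by
  rw [← pow_mul, mul_comm, pow_mul, omega_cube, one_pow]

/-- A cubic product of the values of `q` is a single exponential, with coefficient -3 at `η_0` since
the class 0 does not see `ω`. -/
theorem invValue_sq_mul (lam : ℂ) (i j : ℕ) {a b : ℂ} (ha : -(2 * omega ^ i + omega ^ j) = a)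
    (hb : -(2 * (omega ^ i) ^ 2 + (omega ^ j) ^ 2) = b) :
    invValue lam i ^ 2 * invValue lam j =
      formalExp (-((3 : ℂ) • eta lam 0) + a • eta lam 1 + b • eta lam 2) := by
  rw [invValue, invValue, pow_two, ← formalExp_add, ← formalExp_add,
    powSeries_mul (omega_pow_cube i), powSeries_mul (omega_pow_cube j), ← ha, ← hb]
  congr 1
  module

theorem hasSum_class (lam : ℂ) {s : ℕ} (hs : s < 3) (a : ℕ → ℂ) {u : ℕ → ℱ}
    (hu : ∀ i, HasSum (fun m : ℕ => (a m * (lam * omega ^ i) ^ m) •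
      (expCoeff (-1) m : ℱ)) (u i)) :
    HasSum (fun m : ℕ => (if m % 3 = s then a m * lam ^ m else 0) • (expCoeff (-1) m : ℱ))
      (MvPowerSeries.C (1 / 3) * (u 0 + MvPowerSeries.C (omega ^ (2 * s)) * u 1 +
        MvPowerSeries.C (omega ^ s) * u 2)) := by
  have h := (((hu 0).add ((hu 1).mul_left (MvPowerSeries.C (omega ^ (2 * s))))).add
    ((hu 2).mul_left (MvPowerSeries.C (omega ^ s)))).mul_left (MvPowerSeries.C (1 / 3))
  have he : (fun m : ℕ => (if m % 3 = s then a m * lam ^ m else 0) • (expCoeff (-1) m : ℱ)) =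
      fun m : ℕ => MvPowerSeries.C (1 / 3) * ((a m * (lam * omega ^ 0) ^ m) •
        (expCoeff (-1) m : ℱ) + MvPowerSeries.C (omega ^ (2 * s)) *
          ((a m * (lam * omega ^ 1) ^ m) • (expCoeff (-1) m : ℱ)) +
        MvPowerSeries.C (omega ^ s) *
          ((a m * (lam * omega ^ 2) ^ m) • (expCoeff (-1) m : ℱ))) := by
    funext m
    have h1 := indicator_mod_three lam m hs
    rw [show (if m % 3 = s then a m * lam ^ m else 0) =
      a m * (if m % 3 = s then lam ^ m else 0) by split_ifs <;> simp, h1]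
    simp only [MvPowerSeries.smul_eq_C_mul, map_add, map_mul, pow_zero, mul_one, pow_one]
    ring
  rw [he]
  exact h

theorem formalSin_add_C (u : ℱ) (c : ℂ) :
    formalSin (u + MvPowerSeries.C c) = MvPowerSeries.C (1 / (2 * Complex.I)) *
      (MvPowerSeries.C (Complex.exp (Complex.I * c)) * formalExp (Complex.I • u) -
        MvPowerSeries.C (Complex.exp (-(Complex.I * c))) * formalExp ((-Complex.I) • u)) := by
  have h1 : Complex.I • (u + MvPowerSeries.C c) =
      MvPowerSeries.C (Complex.I * c) + Complex.I • u := by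
    rw [smul_add, map_mul, add_comm, MvPowerSeries.smul_eq_C_mul _ Complex.I]
  have h2 : -(Complex.I • (u + MvPowerSeries.C c)) =
      MvPowerSeries.C (-(Complex.I * c)) + (-Complex.I) • u := by
    rw [h1, map_neg, neg_smul, neg_add]
  rw [formalSin, h2, h1, formalExp_add, formalExp_add, formalExp_C, formalExp_C,
    MvPowerSeries.smul_eq_C_mul]

/-- The sines are split into exponentials: the phases `±2π/3` become `ω` and `ω²`, and `√3 i = 2ω +
1`. The factor `e^(-3η_0)` is `u_0 u_1 u_2`, and each remaining exponential turns it into one of the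
six products `u_i² u_j`. -/
theorem explicitTau_eq (lam : ℂ) :
    explicitTau lam = MvPowerSeries.C ((lam ^ 5)⁻¹ / 27) *
      ((2 * MvPowerSeries.C omega + 1) *
        (MvPowerSeries.C omega * (invValue lam 2 ^ 2 * invValue lam 1) -
          MvPowerSeries.C omega ^ 2 * (invValue lam 1 ^ 2 * invValue lam 2) +
          MvPowerSeries.C omega ^ 2 * (invValue lam 0 ^ 2 * invValue lam 2) -
          MvPowerSeries.C omega * (invValue lam 0 ^ 2 * invValue lam 1) -
          invValue lam 2 ^ 2 * invValue lam 0 + invValue lam 1 ^ 2 * invValue lam 0) +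
        9 * eulerClass lam 2 * (invValue lam 0 * invValue lam 1 * invValue lam 2)) := by
  set s : ℂ := ((Real.sqrt 3 : ℝ) : ℂ) with hs
  have ho : omega = (-1 + s * Complex.I) / 2 := rfl
  have ho2 : omega ^ 2 = (-1 - s * Complex.I) / 2 := omega_sq
  have ho4 : (omega ^ 2) ^ 2 = omega := by
    rw [← pow_mul]
    linear_combination omega * omega_cube
  set F₀ := formalExp (-((3 : ℂ) • eta lam 0)) with hF₀
  have hprod : invValue lam 0 * invValue lam 1 * invValue lam 2 = F₀ := by
    rw [invValue, invValue, invValue, ← formalExp_add, ← formalExp_add, hF₀,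
      powSeries_mul (omega_pow_cube 0), powSeries_mul (omega_pow_cube 1),
      powSeries_mul (omega_pow_cube 2), pow_zero, pow_one, ho4, ho2, ho]
    congr 1
    module
  have h21 : invValue lam 2 ^ 2 * invValue lam 1 = F₀ *
      (formalExp ((3 / 2 : ℂ) • (eta lam 1 + eta lam 2)) *
        formalExp (Complex.I • ((s / 2) • (eta lam 1 - eta lam 2)))) := by
    rw [invValue_sq_mul lam 2 1 rfl rfl, hF₀, ← formalExp_add, ← formalExp_add, pow_one, ho4, ho2,
      ho]
    congr 1
    module
  have h12 : invValue lam 1 ^ 2 * invValue lam 2 = F₀ *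
      (formalExp ((3 / 2 : ℂ) • (eta lam 1 + eta lam 2)) *
        formalExp ((-Complex.I) • ((s / 2) • (eta lam 1 - eta lam 2)))) := by
    rw [invValue_sq_mul lam 1 2 rfl rfl, hF₀, ← formalExp_add, ← formalExp_add, pow_one, ho4, ho2,
      ho]
    congr 1
    module
  have h02 : invValue lam 0 ^ 2 * invValue lam 2 = F₀ *
      (formalExp (-((3 / 2 : ℂ) • (eta lam 1 + eta lam 2))) *
        formalExp (Complex.I • ((s / 2) • (eta lam 1 - eta lam 2)))) := by
    rw [invValue_sq_mul lam 0 2 rfl rfl, hF₀, ← formalExp_add, ← formalExp_add, pow_zero, ho4, ho2,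
      ho]
    congr 1
    module
  have h01 : invValue lam 0 ^ 2 * invValue lam 1 = F₀ *
      (formalExp (-((3 / 2 : ℂ) • (eta lam 1 + eta lam 2))) *
        formalExp ((-Complex.I) • ((s / 2) • (eta lam 1 - eta lam 2)))) := by
    rw [invValue_sq_mul lam 0 1 rfl rfl, hF₀, ← formalExp_add, ← formalExp_add, pow_zero, pow_one,
      ho2, ho]
    congr 1
    module
  have h20 : invValue lam 2 ^ 2 * invValue lam 0 = F₀ *
      formalExp (Complex.I • (s • (eta lam 1 - eta lam 2))) := by
    rw [invValue_sq_mul lam 2 0 rfl rfl, hF₀, ← formalExp_add, pow_zero, ho4, ho2, ho]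
    congr 1
    module
  have h10 : invValue lam 1 ^ 2 * invValue lam 0 = F₀ *
      formalExp ((-Complex.I) • (s • (eta lam 1 - eta lam 2))) := by
    rw [invValue_sq_mul lam 1 0 rfl rfl, hF₀, ← formalExp_add, pow_zero, pow_one, ho2, ho]
    congr 1
    module
  have hsin := formalSin_add_C (s • (eta lam 1 - eta lam 2)) 0
  rw [map_zero, add_zero, mul_zero, neg_zero, Complex.exp_zero, map_one, one_mul, one_mul] at hsin
  have hexplicit : explicitTau lam = (-(s / 27) * (lam ^ 5)⁻¹) • (F₀ *
      ((2 : ℂ) • (formalExp ((3 / 2 : ℂ) • (eta lam 1 + eta lam 2)) *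
        formalSin ((s / 2) • (eta lam 1 - eta lam 2) +
          MvPowerSeries.C (2 * ((Real.pi : ℝ) : ℂ) / 3)))
      + (2 : ℂ) • (formalExp (-((3 / 2 : ℂ) • (eta lam 1 + eta lam 2))) *
        formalSin ((s / 2) • (eta lam 1 - eta lam 2) +
          MvPowerSeries.C (-(2 * ((Real.pi : ℝ) : ℂ) / 3))))
      - (2 : ℂ) • formalSin (s • (eta lam 1 - eta lam 2))
      - (3 * s * lam) • eta' lam 2)) := by
    rw [map_neg, ← sub_eq_add_neg]
    rfl
  rw [hexplicit, formalSin_add_C, formalSin_add_C, hsin, mul_neg, neg_neg,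
    exp_two_pi_div_three_mul_I, exp_neg_two_pi_div_three_mul_I, hprod, h21, h12, h02, h01, h20,
    h10, eulerClass_eq]
  have hsI : (MvPowerSeries.C s : ℱ) * MvPowerSeries.C (1 / (2 * Complex.I)) * 2 =
      -(2 * MvPowerSeries.C omega + 1) := by
    have : s * (1 / (2 * Complex.I)) * 2 = -(2 * omega + 1) := by
      rw [ho, one_div, mul_inv, Complex.inv_I]
      ring
    have h := congrArg (MvPowerSeries.C (σ := ℕ+) (R := ℂ)) this
    simpa only [map_mul, map_neg, map_add, map_one, map_ofNat] using h
  -- Only the term in `η_2'` contains `√3` twice; this produces its coefficient `9 = 3 · 3`.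
  have hss : (MvPowerSeries.C s : ℱ) * MvPowerSeries.C s = 3 := by
    rw [← map_mul, ← pow_two, sqrt_three_sq, map_ofNat]
  generalize formalExp ((3 / 2 : ℂ) • (eta lam 1 + eta lam 2)) = A₁
  generalize formalExp (-((3 / 2 : ℂ) • (eta lam 1 + eta lam 2))) = A₂
  generalize formalExp (Complex.I • ((s / 2) • (eta lam 1 - eta lam 2))) = E₁
  generalize formalExp ((-Complex.I) • ((s / 2) • (eta lam 1 - eta lam 2))) = E₂
  generalize formalExp (Complex.I • (s • (eta lam 1 - eta lam 2))) = G₁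
  generalize formalExp ((-Complex.I) • (s • (eta lam 1 - eta lam 2))) = G₂
  clear_value F₀
  generalize MvPowerSeries.C (1 / (2 * Complex.I)) = J at hsI ⊢
  simp only [MvPowerSeries.smul_eq_C_mul, map_mul, map_neg, div_eq_mul_inv, map_ofNat, map_pow]
  generalize (MvPowerSeries.C s : ℱ) = S at hsI hss ⊢
  generalize (MvPowerSeries.C (lam ^ 5)⁻¹ : ℱ) = k
  generalize (MvPowerSeries.C (27 : ℂ)⁻¹ : ℱ) = t
  linear_combination (-(k * t * F₀ * (A₁ * (MvPowerSeries.C omega * E₁ -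
      MvPowerSeries.C omega ^ 2 * E₂) + A₂ * (MvPowerSeries.C omega ^ 2 * E₁ -
      MvPowerSeries.C omega * E₂) - (G₁ - G₂)))) * hsI +
    (3 * k * t * F₀ * MvPowerSeries.C lam * eta' lam 2) * hss

theorem tendsto_det_stdMatrix_explicitTau {lam : ℂ} (hlam : lam ≠ 0) :
    Tendsto (fun L : ℕ => ((stdMatrix lam (6 + L)).det : ℱ)) atTop (𝓝 (explicitTau lam)) := by
  set u : ℕ → ℱ := invValue lam with hu
  set v : ℕ → ℱ := fun i =>
    (-1 : ℂ) • (eulerSeries (lam * omega ^ i) * invValue lam i) with hv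
  set V : ℕ → ℱ := fun s => u 0 + MvPowerSeries.C (omega ^ (2 * s)) * u 1 +
    MvPowerSeries.C (omega ^ s) * u 2 with hV
  set Y : ℕ → ℱ := fun s => v 0 + MvPowerSeries.C (omega ^ (2 * s)) * v 1 +
    MvPowerSeries.C (omega ^ s) * v 2 with hY
  have h1 := tendsto_det_stdMatrix hlam (fun s => MvPowerSeries.C (1 / 3) * V s)
    (fun s => MvPowerSeries.C (1 / 3) * Y s)
    (fun s hs => by
      simpa only [one_mul] using hasSum_class lam hs (fun _ => 1) (u := u) fun i => by
        simpa only [one_mul] using! hasSum_pow_smul_expCoeff (-1) (lam * omega ^ i))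
    (fun s hs => hasSum_class lam hs (fun m => (m : ℂ)) (u := v) fun i =>
        hasSum_mul_pow_smul_expCoeff (-1) (lam * omega ^ i))
  convert h1 using 2
  have hW : (MvPowerSeries.C omega : ℱ) ^ 2 + MvPowerSeries.C omega + 1 = 0 := by
    rw [← map_pow, ← map_add, ← map_one MvPowerSeries.C, ← map_add, omega_relation, map_zero]
  have hω4 : omega ^ 4 = omega := by linear_combination omega * omega_cube
  have hv' : ∀ i, v i = -((eulerClass lam 0 + MvPowerSeries.C (omega ^ i) * eulerClass lam 1 +
      MvPowerSeries.C ((omega ^ i) ^ 2) * eulerClass lam 2) * u i) := by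
    intro i
    simp only [hv, hu]
    rw [neg_one_smul, eulerSeries_mul (omega_pow_cube i), MvPowerSeries.smul_eq_C_mul,
      MvPowerSeries.smul_eq_C_mul]
  have h2 := det_circulant_expansion hW (u 0) (u 1) (u 2) (eulerClass lam 0) (eulerClass lam 1)
    (eulerClass lam 2) (V0 := V 0) (V1 := V 1) (V2 := V 2) (Y0 := Y 0) (Y1 := Y 1) (Y2 := Y 2)
    (v0 := v 0) (v1 := v 1) (v2 := v 2) (by simp [hV]) (by simp [hV])
    (by simp only [hV, Nat.reduceMul, hω4]; rw [map_pow]) (by rw [hv']; simp) (by rw [hv']; simp)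
    (by rw [hv', ← pow_mul, hω4, map_pow]) (by simp [hY]) (by simp [hY])
    (by simp only [hY, Nat.reduceMul, hω4]; rw [map_pow])
  rw [explicitTau_eq]
  -- Three factors `1/3` come from the filter in the three columns, one from `classDer`, and the
  -- factor 3 from `det_circulant_expansion`.
  have h27 : (MvPowerSeries.C ((lam ^ 5)⁻¹ / 27) : ℱ) =
      MvPowerSeries.C ((lam ^ 5)⁻¹ / 3) * MvPowerSeries.C (1 / 3) ^ 3 * 3 := by
    rw [← map_pow, ← map_mul, ← map_ofNat MvPowerSeries.C 3, ← map_mul]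
    congr 1
    ring
  rw [Matrix.det_fin_three] at h2 ⊢
  simp only [Matrix.of_apply, Matrix.cons_val] at h2 ⊢
  simp only [← hu]
  clear_value u V Y
  generalize (MvPowerSeries.C ((lam ^ 5)⁻¹ / 3) : ℱ) = k at h27 ⊢
  generalize (MvPowerSeries.C (1 / 3) : ℱ) = t at h27 ⊢
  rw [h27]
  linear_combination (-(k * t ^ 3)) * h2

end Explicit

/-! ### The Cauchy–Binet formula -/

theorem det_mul_eq_sum_prod_mul_det {N : ℕ} {ι R : Type*} [Fintype ι] [DecidableEq ι] [CommRing R]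
    (A : Matrix (Fin N) ι R) (B : Matrix ι (Fin N) R) :
    (A * B).det = ∑ f : Fin N → ι, (∏ i, A i (f i)) * (B.submatrix f id).det := by
  have h : (A * B).det = Matrix.detRowAlternating.toMultilinearMap
      (fun i => ∑ e, A i e • B e) := by
    change (A * B).det = Matrix.det _
    congr 1
    ext i j
    simp [Matrix.mul_apply]
  rw [h, MultilinearMap.map_sum]
  refine Finset.sum_congr rfl fun f _ => ?_
  rw [MultilinearMap.map_smul_univ]
  rfl

/-- Choices of rows with a repetition contribute 0. An injective choice is uniquely a strictly
increasing one followed by a permutation, and the sum over permutations is the minor of `A`. -/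
theorem det_mul_eq_sum_strictMono {N : ℕ} {ι R : Type*} [Fintype ι] [LinearOrder ι] [CommRing R]
    (A : Matrix (Fin N) ι R) (B : Matrix ι (Fin N) R) :
    (A * B).det = ∑ g : Fin N → ι with StrictMono g,
      (A.submatrix id g).det * (B.submatrix g id).det := by
  classical
  have h1 : (A * B).det = ∑ f : Fin N → ι with Function.Injective f,
      (∏ i, A i (f i)) * (B.submatrix f id).det := by
    rw [det_mul_eq_sum_prod_mul_det]
    refine (Finset.sum_subset (Finset.filter_subset _ _) fun f _ hf => ?_).symm
    obtain ⟨i, j, hij, hne⟩ : ∃ i j, f i = f j ∧ i ≠ j := by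
      have hf' : ¬ Function.Injective f := by simpa using hf
      simpa [Function.Injective] using hf'
    rw [Matrix.det_zero_of_row_eq hne, mul_zero]
    ext k
    simp [hij]
  have h2 : ∑ f : Fin N → ι with Function.Injective f,
      (∏ i, A i (f i)) * (B.submatrix f id).det =
      ∑ p ∈ (Finset.univ.filter fun g : Fin N → ι => StrictMono g) ×ˢ
        (Finset.univ : Finset (Equiv.Perm (Fin N))),
        (∏ i, A i (p.1 (p.2 i))) * (B.submatrix (p.1 ∘ p.2) id).det := by
    refine Finset.sum_nbij' (fun f => (f ∘ Tuple.sort f, (Tuple.sort f).symm))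
      (fun p => p.1 ∘ p.2) ?_ ?_ ?_ ?_ ?_
    · intro f hf
      have hf' : Function.Injective f := by simpa using hf
      simp only [Finset.mem_product, Finset.mem_filter, Finset.mem_univ, true_and, and_true]
      exact (Tuple.monotone_sort f).strictMono_of_injective
        (hf'.comp (Tuple.sort f).injective)
    · rintro ⟨g, σ⟩ hp
      have hg : StrictMono g := by simpa using hp
      simpa using hg.injective.comp σ.injective
    · intro f _
      funext i
      simp
    · rintro ⟨g, σ⟩ hp
      have hg : StrictMono g := by simpa using hp
      have hs : σ.symm = Tuple.sort (g ∘ σ) := by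
        rw [Tuple.eq_sort_iff]
        refine ⟨?_, fun i j hij h => ?_⟩
        · rw [Function.comp_assoc, Equiv.self_comp_symm, Function.comp_id]
          exact hg.monotone
        · simp only [Function.comp_apply, Equiv.apply_symm_apply] at h
          exact absurd (hg.injective h) hij.ne
      simp only [← hs, Equiv.symm_symm, Prod.mk.injEq, and_true]
      rw [Function.comp_assoc, Equiv.self_comp_symm, Function.comp_id]
    · intro f _
      have : (f ∘ Tuple.sort f) ∘ (Tuple.sort f).symm = f := by
        funext i
        simp
      simp only [this]
      congr 1
      refine Finset.prod_congr rfl fun i _ => ?_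
      simp
  rw [h1, h2, Finset.sum_product]
  refine Finset.sum_congr rfl fun g _ => ?_
  rw [← Matrix.det_transpose (A.submatrix id g), Matrix.det_apply, Finset.sum_mul]
  refine Finset.sum_congr rfl fun σ _ => ?_
  have h3 : B.submatrix (g ∘ σ) id = (B.submatrix g id).submatrix σ id := rfl
  rw [h3, Matrix.det_permute]
  simp only [Matrix.transpose_apply, Matrix.submatrix_apply, id_eq, Units.smul_def, zsmul_eq_mul]
  ring

/-! ### Determinants whose lower right corner is unitriangular -/

/-- This makes Plücker coordinates, Schur functions and transition determinants independent of the
size of truncation. -/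
theorem det_eq_det_of_unitriangular {R : Type*} [CommRing R] (A : ℕ → ℕ → R) {M N : ℕ}
    (hMN : M ≤ N) (h0 : ∀ i j, M ≤ i → j < i → A i j = 0) (h1 : ∀ i, M ≤ i → A i i = 1) :
    (Matrix.of fun i j : Fin N => A i j).det = (Matrix.of fun i j : Fin M => A i j).det := by
  obtain ⟨K, rfl⟩ := Nat.exists_eq_add_of_le hMN
  rw [← Matrix.det_submatrix_equiv_self finSumFinEquiv]
  have hb : (Matrix.of fun i j : Fin (M + K) => A i j).submatrix finSumFinEquiv finSumFinEquiv =
      Matrix.fromBlocks (Matrix.of fun i j : Fin M => A i j)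
        (Matrix.of fun (i : Fin M) (j : Fin K) => A i (M + j)) 0
        (Matrix.of fun i j : Fin K => A (M + i) (M + j)) := by
    ext i j
    rcases i with i | i <;> rcases j with j | j <;> simp
    exact h0 _ _ (by omega) (by omega)
  rw [hb, Matrix.det_fromBlocks_zero₂₁, Matrix.det_of_isUpperTriangular
    (M := Matrix.of fun i j : Fin K => A (M + i) (M + j)), Finset.prod_eq_one, mul_one]
  · intro i _
    exact h1 _ (by omega)
  · intro i j hij
    have : (j : ℕ) < i := hij
    exact h0 _ _ (by omega) (by omega)

/-! ### Partitions -/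

theorem part_eq_zero {n : ℕ} (μ : Nat.Partition n) {i : ℕ} (hi : μ.parts.card ≤ i) :
    part μ i = 0 := by
  rw [part, List.getD_eq_default]
  simpa using hi

theorem card_parts_le {n : ℕ} (μ : Nat.Partition n) : μ.parts.card ≤ n := by
  have h : μ.parts.card • 1 ≤ μ.parts.sum :=
    Multiset.card_nsmul_le_sum fun x hx => μ.parts_pos hx
  simpa [μ.parts_sum] using h

theorem antitone_part {n : ℕ} (μ : Nat.Partition n) : Antitone (part μ) := by
  intro i j hij
  rw [part, part]
  by_cases hj : j < (μ.parts.sort (· ≥ ·)).length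
  · rw [List.getD_eq_getElem _ _ hj, List.getD_eq_getElem _ _ (hij.trans_lt hj)]
    rcases hij.eq_or_lt with rfl | hlt
    · exact le_rfl
    · exact List.pairwise_iff_getElem.mp (Multiset.pairwise_sort μ.parts (· ≥ ·)) i j _ hj hlt
  · rw [List.getD_eq_default _ _ (not_lt.mp hj)]
    exact Nat.zero_le _

theorem sum_range_part {n N : ℕ} (μ : Nat.Partition n) (hN : μ.parts.card ≤ N) :
    ∑ i ∈ Finset.range N, part μ i = n := by
  rw [← Finset.sum_subset (Finset.range_subset_range.mpr hN)]
  · conv_rhs => rw [← μ.parts_sum, ← Multiset.sort_eq μ.parts (· ≥ ·), Multiset.sum_coe]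
    have hlen : (μ.parts.sort (· ≥ ·)).length = μ.parts.card := by simp
    rw [← hlen, Finset.sum_range, ← List.sum_ofFn]
    congr 1
    refine List.ext_getElem (by simp) fun i h1 h2 => ?_
    rw [List.getElem_ofFn, part, List.getD_eq_getElem _ _ h2]
  · intro i _ hi
    exact part_eq_zero μ (by simpa using hi)

theorem part_injective {n : ℕ} {μ ν : Nat.Partition n} (h : ∀ i, part μ i = part ν i) : μ = ν := by
  have key : ∀ (ρ : Nat.Partition n) (i : ℕ), (ρ.parts.sort (· ≥ ·))[i]? =
      if part ρ i = 0 then none else some (part ρ i) := by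
    intro ρ i
    by_cases hi : i < (ρ.parts.sort (· ≥ ·)).length
    · have hp : part ρ i = (ρ.parts.sort (· ≥ ·))[i] := List.getD_eq_getElem _ _ hi
      have hpos : 0 < part ρ i := by
        rw [hp]
        exact ρ.parts_pos (Multiset.mem_sort (r := (· ≥ ·)) |>.mp (List.getElem_mem hi))
      rw [if_neg hpos.ne', hp, List.getElem?_eq_getElem hi]
    · rw [List.getElem?_eq_none (not_lt.mp hi), if_pos]
      exact List.getD_eq_default _ _ (not_lt.mp hi)
  have hl : μ.parts.sort (· ≥ ·) = ν.parts.sort (· ≥ ·) := by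
    refine List.ext_getElem? fun i => ?_
    rw [key, key, h]
  ext1
  rw [← Multiset.sort_eq μ.parts (· ≥ ·), hl, Multiset.sort_eq]

/-- The zeros of a decreasing list stand at its end, where the default value 0 replaces them. -/
theorem getD_filter_ne_zero (L : List ℕ) (hL : L.Pairwise (· ≥ ·)) (i : ℕ) :
    (L.filter (· ≠ 0)).getD i 0 = L.getD i 0 := by
  induction L generalizing i with
  | nil => simp
  | cons a L ih =>
    rw [List.pairwise_cons] at hL
    by_cases ha : a = 0
    · subst ha
      have h0 : ∀ b ∈ L, b = 0 := fun b hb => Nat.le_zero.mp (hL.1 b hb)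
      have h1 : (0 :: L).filter (· ≠ 0) = [] := by
        rw [List.filter_eq_nil_iff]
        intro b hb
        rcases List.mem_cons.mp hb with rfl | hb
        · simp
        · simp [h0 b hb]
      rw [h1, List.getD_nil]
      by_cases hi : i < (0 :: L).length
      · rw [List.getD_eq_getElem _ _ hi]
        rcases List.mem_cons.mp (List.getElem_mem hi) with h | h
        · exact h.symm
        · exact (h0 _ h).symm
      · rw [List.getD_eq_default _ _ (not_lt.mp hi)]
    · rw [List.filter_cons_of_pos (by simpa using ha)]
      rcases i with _ | i
      · simp
      · simpa using ih hL.2 i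

theorem exists_partition {n N : ℕ} (a : Fin N → ℕ) (ha : Antitone a) (hs : ∑ i, a i = n) :
    ∃ μ : Nat.Partition n, ∀ i : Fin N, part μ i = a i := by
  refine ⟨Nat.Partition.ofSums n (List.ofFn a : List ℕ) ?_, fun i => ?_⟩
  · rw [Multiset.sum_coe, List.sum_ofFn, hs]
  · have hp : (List.ofFn a).Pairwise (· ≥ ·) := by
      rw [List.pairwise_ofFn]
      exact fun i j hij => ha hij.le
    have h1 : (Nat.Partition.ofSums n (List.ofFn a : List ℕ)
        (by rw [Multiset.sum_coe, List.sum_ofFn, hs])).parts.sort (· ≥ ·) =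
        (List.ofFn a).filter (· ≠ 0) := by
      rw [Nat.Partition.ofSums_parts, Multiset.filter_coe, Multiset.coe_sort]
      exact List.mergeSort_eq_self _ (hp.filter _)
    rw [part, h1, getD_filter_ne_zero _ hp, List.getD_eq_getElem _ _ (by simp)]
    simp

/-! ### Expansion of the truncated determinant in Schur functions -/

section Expansion

open Filter Topology

theorem part_le {n : ℕ} (μ : Nat.Partition n) (i : ℕ) : part μ i ≤ n := by
  by_cases hi : i < μ.parts.card
  · refine le_of_le_of_eq ?_ (sum_range_part μ le_rfl)
    exact Finset.single_le_sum (f := part μ) (fun _ _ => Nat.zero_le _) (Finset.mem_range.mpr hi)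
  · rw [part_eq_zero μ (not_lt.mp hi)]
    exact Nat.zero_le _

/-- Beyond the length of `μ` row `i` is the exponent `-i`, so the normalization of the frame makes
the added corner unitriangular. -/
theorem plucker_eq_det {U : Submodule ℂ (LaurentSeries ℂ)} {l : ℕ} {X : ℕ → LaurentSeries ℂ}
    (hX : IsFrame U l X) {n : ℕ} (μ : Nat.Partition n) {N : ℕ}
    (hN : max (l + 1) (μ.parts.card + 1) ≤ N) :
    plucker l X μ =
      (Matrix.of fun i j : Fin N => (X j).coeff ((part μ i : ℤ) - ((i : ℕ) : ℤ))).det := by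
  rw [plucker]
  refine (det_eq_det_of_unitriangular
    (fun i j => (X j).coeff ((part μ i : ℤ) - (i : ℤ))) hN (fun i j hi hj => ?_)
    fun i hi => ?_).symm
  · rw [part_eq_zero μ (by omega), Nat.cast_zero, zero_sub]
    by_cases hl : l ≤ j
    · exact hX.coeff_above j hl _ (by omega)
    · exact hX.coeff_above_block j (not_le.mp hl) _ (by omega)
  · rw [part_eq_zero μ (by omega), Nat.cast_zero, zero_sub]
    exact hX.coeff_diag i (by omega)

theorem elemSchur_zero : elemSchur 0 = 1 := (elemSchur_natCast 0).trans (expCoeff_zero _)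

theorem schur_eq_det {n : ℕ} (μ : Nat.Partition n) {N : ℕ} (hN : μ.parts.card ≤ N) :
    schur μ = (Matrix.of fun i j : Fin N =>
      elemSchur ((part μ i : ℤ) - ((i : ℕ) : ℤ) + ((j : ℕ) : ℤ))).det := by
  rw [schur]
  refine (det_eq_det_of_unitriangular
    (fun i j => elemSchur ((part μ i : ℤ) - (i : ℤ) + (j : ℤ))) hN (fun i j hi hj => ?_)
    fun i hi => ?_).symm
  · rw [part_eq_zero μ hi]
    exact elemSchur_of_neg (by omega)
  · rw [part_eq_zero μ hi, Nat.cast_zero, zero_sub, neg_add_cancel, elemSchur_zero]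

/-- The term of a permutation `σ` has weight `∑ (a (σ i) + i)`, which does not depend on `σ`, unless
one of its indices is negative and the term is 0. -/
theorem isWeightedHomogeneous_det_elemSchur {n N : ℕ} (a : Fin N → ℤ)
    (ha : ∑ i, (a i + ((i : ℕ) : ℤ)) = n) :
    MvPolynomial.IsWeightedHomogeneous (fun j : ℕ+ => (j : ℕ))
      (Matrix.of fun i k : Fin N => elemSchur (a i + ((k : ℕ) : ℤ))).det n := by
  rw [Matrix.det_apply, ← MvPolynomial.mem_weightedHomogeneousSubmodule ℂ]
  refine Submodule.sum_mem _ fun σ _ => ?_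
  rw [Units.smul_def]
  refine zsmul_mem ?_ _
  simp only [Matrix.of_apply]
  by_cases h : ∀ i, 0 ≤ a (σ i) + ((i : ℕ) : ℤ)
  · rw [MvPolynomial.mem_weightedHomogeneousSubmodule]
    have hp := MvPolynomial.IsWeightedHomogeneous.prod (w := fun j : ℕ+ => (j : ℕ)) Finset.univ
      (fun i : Fin N => elemSchur (a (σ i) + ((i : ℕ) : ℤ)))
      (fun i => (a (σ i) + ((i : ℕ) : ℤ)).toNat) fun i _ => by
        conv_lhs => rw [← Int.toNat_of_nonneg (h i)]
        exact isWeightedHomogeneous_elemSchur _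
    convert hp
    zify
    rw [← ha, Finset.sum_congr rfl fun i _ => Int.toNat_of_nonneg (h i), Finset.sum_add_distrib,
      Finset.sum_add_distrib, Equiv.sum_comp σ a]
  · push Not at h
    obtain ⟨i, hi⟩ := h
    rw [Finset.prod_eq_zero (Finset.mem_univ i) (elemSchur_of_neg hi)]
    exact Submodule.zero_mem _

theorem isWeightedHomogeneous_schur {n : ℕ} (μ : Nat.Partition n) :
    MvPolynomial.IsWeightedHomogeneous (fun j : ℕ+ => (j : ℕ)) (schur μ) n := by
  refine isWeightedHomogeneous_det_elemSchur
    (fun i : Fin μ.parts.card => (part μ i : ℤ) - ((i : ℕ) : ℤ)) ?_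
  simp only [sub_add_cancel]
  rw [← Nat.cast_sum, ← Finset.sum_range (part μ), sum_range_part μ le_rfl]

/-- The coefficients of `z^(B - r)` in the first `N` members of a sequence of Laurent series. -/
def coeffMatrix (X : ℕ → LaurentSeries ℂ) (B N : ℕ) :
    Matrix (Fin N) (Fin (B + N)) (MvPolynomial ℕ+ ℂ) :=
  Matrix.of fun j r => MvPolynomial.C ((X j).coeff ((B : ℤ) - ((r : ℕ) : ℤ)))

/-- The rows `(p_{B - r + k})_k`. -/
def elemSchurMatrix (B N : ℕ) : Matrix (Fin (B + N)) (Fin N) (MvPolynomial ℕ+ ℂ) :=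
  Matrix.of fun r k => elemSchur ((B : ℤ) - ((r : ℕ) : ℤ) + ((k : ℕ) : ℤ))

/-- The window of exponents from `B` down to `1 - N` suffices: the frame has none above 3, and
`p_{e+k} = 0` for `k < N` and `e < 1 - N`. -/
theorem stdMatrix_eq_mul (lam : ℂ) (N : ℕ) {B : ℕ} (hB : 3 ≤ B) :
    stdMatrix lam N = coeffMatrix (stdFrame lam) B N * elemSchurMatrix B N := by
  ext1 j k
  have hinj : Function.Injective fun r : Fin (B + N) => (B : ℤ) - ((r : ℕ) : ℤ) := by
    intro r s h
    simp only [sub_right_inj, Nat.cast_inj] at h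
    exact Fin.ext h
  rw [Matrix.mul_apply, stdMatrix, Matrix.of_apply,
    ← sum_coeff_stdFrame_smul lam j (Finset.univ.map ⟨_, hinj⟩) _ ?_, Finset.sum_map]
  · refine Finset.sum_congr rfl fun r _ => ?_
    rw [MvPolynomial.smul_eq_C_mul]
    rfl
  · intro e he hs
    refine elemSchur_of_neg ?_
    by_contra hneg
    refine hs (Finset.mem_map.mpr ⟨⟨((B : ℤ) - e).toNat, ?_⟩, Finset.mem_univ _, ?_⟩)
    · have := k.2
      omega
    · simp only [Function.Embedding.coeFn_mk]
      omega

theorem det_submatrix_coeffMatrix (X : ℕ → LaurentSeries ℂ) (B N : ℕ) (g : Fin N → Fin (B + N)) :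
    ((coeffMatrix X B N).submatrix id g).det = MvPolynomial.C (Matrix.of fun i j : Fin N =>
      (X j).coeff ((B : ℤ) - ((g i : ℕ) : ℤ))).det := by
  rw [RingHom.map_det, ← Matrix.det_transpose]
  rfl

theorem add_sub_le_of_strictMono {M N : ℕ} {g : Fin N → Fin M} (hg : StrictMono g) {i j : Fin N}
    (hij : i ≤ j) : (g i : ℕ) + ((j : ℕ) - (i : ℕ)) ≤ g j := by
  obtain ⟨j, hj⟩ := j
  have h : (i : ℕ) ≤ j := hij
  obtain ⟨d, rfl⟩ := Nat.exists_eq_add_of_le h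
  clear h hij
  induction d with
  | zero => simp
  | succ d ih =>
    have h1 := ih (by omega)
    have h2 : (g ⟨i + d, by omega⟩ : ℕ) < g ⟨i + (d + 1), hj⟩ :=
      hg (Fin.mk_lt_mk.mpr (by omega))
    simp only at h1 ⊢
    omega

/-- The rows that belong to a partition. -/
def partitionRows {n : ℕ} (B N : ℕ) (μ : Nat.Partition n) (i : Fin N) : Fin (B + N) :=
  ⟨B + i - part μ i, by omega⟩

/-- In the Cauchy–Binet sum, increasing choices `g` of rows match partitions through `μ_i = B + i -
g_i`, and homogeneity keeps only those of size `wt m`. All of these fit into the window, since their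
parts and lengths are at most `wt m`. -/
theorem coeff_det_stdMatrix {U : Submodule ℂ (LaurentSeries ℂ)} {lam : ℂ}
    (hX : IsFrame U 3 (stdFrame lam)) (m : ℕ+ →₀ ℕ) {N : ℕ} (hN : wt m + 4 ≤ N) :
    MvPolynomial.coeff m (stdMatrix lam N).det =
      ∑ μ : Nat.Partition (wt m), plucker 3 (stdFrame lam) μ * MvPolynomial.coeff m (schur μ) := by
  classical
  set n := wt m with hn
  set B := n + 3 with hB
  rw [stdMatrix_eq_mul lam N (B := B) (by omega), det_mul_eq_sum_strictMono,
    MvPolynomial.coeff_sum]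
  have hle : ∀ (μ : Nat.Partition n) (i : ℕ), part μ i ≤ B + i := fun μ i =>
    (part_le μ i).trans (by omega)
  symm
  refine Finset.sum_of_injOn (partitionRows B N) ?_ ?_ ?_ ?_
  · intro μ _ ν _ h
    refine part_injective fun i => ?_
    by_cases hi : i < N
    · have h1 := congrArg Fin.val (congrFun h ⟨i, hi⟩)
      simp only [partitionRows] at h1
      have := hle μ i
      have := hle ν i
      omega
    · have := card_parts_le μ
      have := card_parts_le ν
      rw [part_eq_zero μ (by omega), part_eq_zero ν (by omega)]
  · intro μ _
    simp only [Finset.coe_filter, Finset.mem_univ, true_and, Set.mem_ofPred_eq]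
    intro i j hij
    have h1 : (i : ℕ) < j := hij
    have h2 := antitone_part μ h1.le
    have h3 := hle μ i
    have h4 := hle μ j
    change B + (i : ℕ) - part μ i < B + (j : ℕ) - part μ j
    omega
  · intro g hg hne
    have hmono : StrictMono g := by simpa using hg
    -- A strictly increasing choice must leave room for the `N - 1 - i` later rows, so the parts `B
    -- + i - g i` are not truncated subtractions.
    have hgle : ∀ i, (g i : ℕ) ≤ B + i := by
      intro i
      have h1 := add_sub_le_of_strictMono hmono (i := i) (j := ⟨N - 1, by omega⟩)
        (Fin.mk_le_mk.mpr (by omega))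
      have h2 := (g ⟨N - 1, by omega⟩).2
      simp only at h1
      omega
    set a : Fin N → ℕ := fun i => B + i - g i with ha
    have hanti : Antitone a := by
      intro i j hij
      have h1 := add_sub_le_of_strictMono hmono hij
      have h2 := hgle i
      have h3 := hgle j
      have h4 : (i : ℕ) ≤ j := hij
      simp only [ha]
      omega
    have hsum : ∑ i, a i ≠ n := by
      intro hs
      obtain ⟨μ, hμ⟩ := exists_partition a hanti hs
      refine hne ⟨μ, Finset.mem_coe.mpr (Finset.mem_univ _), ?_⟩
      funext i
      refine Fin.ext ?_
      change B + (i : ℕ) - part μ i = g i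
      have := hgle i
      rw [hμ]
      simp only [ha]
      omega
    have hw := isWeightedHomogeneous_det_elemSchur (n := ∑ i, a i)
      (fun i : Fin N => (B : ℤ) - ((g i : ℕ) : ℤ)) (by
        rw [Nat.cast_sum]
        refine Finset.sum_congr rfl fun i _ => ?_
        have := hgle i
        simp only [ha]
        omega)
    rw [det_submatrix_coeffMatrix, MvPolynomial.coeff_C_mul]
    exact mul_eq_zero_of_right _ (hw.coeff_eq_zero m fun h => hsum (h.symm.trans hn.symm))
  · intro μ _
    have hcard := card_parts_le μ
    rw [plucker_eq_det hX μ (N := N) (by omega), schur_eq_det μ (N := N) (by omega),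
      det_submatrix_coeffMatrix, MvPolynomial.coeff_C_mul]
    have hrow : ∀ i : Fin N, (B : ℤ) - ((partitionRows B N μ i : ℕ) : ℤ) =
        (part μ i : ℤ) - ((i : ℕ) : ℤ) := by
      intro i
      have := hle μ i
      simp only [partitionRows]
      omega
    congr 2
    · simp only [hrow]
    · congr 1
      ext1 i j
      simp only [Matrix.of_apply, Matrix.submatrix_apply, elemSchurMatrix, hrow, id_eq]

theorem isTau_stdFrame {U : Submodule ℂ (LaurentSeries ℂ)} {lam : ℂ} (hlam : lam ≠ 0)
    (hX : IsFrame U 3 (stdFrame lam)) : IsTau 3 (stdFrame lam) (explicitTau lam) := by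
  classical
  rw [IsTau, MvPowerSeries.WithPiTopology.hasSum_iff_hasSum_coeff]
  intro m
  have h1 : MvPowerSeries.coeff m (explicitTau lam) =
      ∑ μ : Nat.Partition (wt m), plucker 3 (stdFrame lam) μ * MvPolynomial.coeff m (schur μ) := by
    have ht := (MvPowerSeries.WithPiTopology.tendsto_iff_coeff_tendsto _ _ _).mp
      (tendsto_det_stdMatrix_explicitTau hlam) m
    -- For fixed `m` the coefficient of the determinant is constant once `L ≥ wt m`, so the analytic
    -- limit equals the finite sum over partitions.
    refine tendsto_nhds_unique ht (tendsto_const_nhds.congr' ?_)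
    filter_upwards [eventually_ge_atTop (wt m)] with L hL
    rw [MvPolynomial.coeff_coe, coeff_det_stdMatrix hX m (by omega)]
  let s : Finset (Σ n : ℕ, Nat.Partition n) :=
    (Finset.univ : Finset (Nat.Partition (wt m))).map ⟨Sigma.mk (wt m), sigma_mk_injective⟩
  have h2 : ∑ p ∈ s, MvPowerSeries.coeff m
      (plucker 3 (stdFrame lam) p.2 • (schur p.2 : MvPowerSeries ℕ+ ℂ)) =
        MvPowerSeries.coeff m (explicitTau lam) := by
    rw [h1, Finset.sum_map]
    refine Finset.sum_congr rfl fun μ _ => ?_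
    rw [map_smul, MvPolynomial.coeff_coe, smul_eq_mul]
    rfl
  rw [← h2]
  refine hasSum_sum_of_ne_finset_zero fun p hp => ?_
  rw [map_smul, MvPolynomial.coeff_coe, (isWeightedHomogeneous_schur p.2).coeff_eq_zero m,
    smul_zero]
  intro h
  obtain ⟨n, μ⟩ := p
  obtain rfl : wt m = n := h
  exact hp (Finset.mem_map.mpr ⟨μ, Finset.mem_univ _, rfl⟩)

end Expansion

/-! ### The standard frame -/

/-- In a vanishing combination, the coefficient at the least leading exponent comes from a single
member. -/
theorem linearIndependent_of_coeff {X : ℕ → LaurentSeries ℂ} (d : ℕ → ℤ)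
    (hd : Function.Injective d) (h1 : ∀ j, (X j).coeff (d j) = 1)
    (h0 : ∀ j, ∀ e < d j, (X j).coeff e = 0) : LinearIndependent ℂ X := by
  classical
  rw [linearIndependent_iff']
  intro s g hg i hi
  by_contra hne
  obtain ⟨k, hk, hmin⟩ := (s.filter fun j => g j ≠ 0).exists_min_image d
    ⟨i, Finset.mem_filter.mpr ⟨hi, hne⟩⟩
  rw [Finset.mem_filter] at hk
  have h2 := congrArg (fun F : LaurentSeries ℂ => F.coeff (d k)) hg
  simp only [HahnSeries.coeff_sum, HahnSeries.coeff_smul, HahnSeries.coeff_zero] at h2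
  rw [Finset.sum_eq_single k] at h2
  · rw [h1, smul_eq_mul, mul_one] at h2
    exact hk.2 h2
  · intro j hj hjk
    by_cases hgj : g j = 0
    · rw [hgj, zero_smul]
    · rw [h0 j, smul_zero]
      exact lt_of_le_of_ne (hmin j (Finset.mem_filter.mpr ⟨hj, hgj⟩)) fun h => hjk (hd h).symm
  · exact fun h => absurd hk.1 h

theorem coeff_stdFrame_zero (lam : ℂ) (e : ℤ) :
    (stdFrame lam 0).coeff e = (if e = 0 then 1 else 0) - if e = 3 then lam ^ 3 else 0 := by
  rw [stdFrame_zero, HahnSeries.coeff_sub, HahnSeries.coeff_single, HahnSeries.coeff_single]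
  congr

theorem coeff_stdFrame_one (lam : ℂ) (e : ℤ) :
    (stdFrame lam 1).coeff e = (if e = -1 then 1 else 0) - if e = 2 then lam ^ 3 else 0 := by
  rw [stdFrame_one, HahnSeries.coeff_sub, HahnSeries.coeff_single, HahnSeries.coeff_single]
  congr

theorem coeff_stdFrame_two (lam : ℂ) (e : ℤ) :
    (stdFrame lam 2).coeff e = if e = 3 then 1 else 0 := by
  rw [stdFrame, HahnSeries.coeff_single]
  congr

theorem coeff_stdFrame_add_three (lam : ℂ) (j : ℕ) (e : ℤ) :
    (stdFrame lam (j + 3)).coeff e = (if e = -((j : ℤ) + 3) then 1 else 0) -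
      (if e = -(j : ℤ) then 2 * lam ^ 3 else 0) + if e = 3 - (j : ℤ) then lam ^ 6 else 0 := by
  rw [stdFrame_add_three, HahnSeries.coeff_add, HahnSeries.coeff_sub, HahnSeries.coeff_single,
    HahnSeries.coeff_single, HahnSeries.coeff_single]
  congr

theorem linearIndependent_stdFrame (lam : ℂ) : LinearIndependent ℂ (stdFrame lam) := by
  -- The leading exponents are `0, -1, 3, -3, -4, …`; only the third member `z³` breaks the pattern
  -- `-j`.
  refine linearIndependent_of_coeff (fun j => if j = 2 then 3 else -(j : ℤ)) ?_ ?_ ?_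
  · intro i j h
    dsimp only at h
    split_ifs at h <;> omega
  · intro j
    match j with
    | 0 => simp [coeff_stdFrame_zero]
    | 1 => simp [coeff_stdFrame_one]
    | 2 => simp [coeff_stdFrame_two]
    | j + 3 =>
      rw [if_neg (by omega), coeff_stdFrame_add_three, if_pos (by push_cast; ring),
        if_neg (by push_cast; omega), if_neg (by push_cast; omega), sub_zero, add_zero]
  · intro j e he
    match j with
    | 0 =>
      simp only [OfNat.zero_ne_ofNat, if_false, CharP.cast_eq_zero, neg_zero] at he
      rw [coeff_stdFrame_zero, if_neg (by omega), if_neg (by omega), sub_zero]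
    | 1 =>
      simp only [OfNat.one_ne_ofNat, if_false, Nat.cast_one] at he
      rw [coeff_stdFrame_one, if_neg (by omega), if_neg (by omega), sub_zero]
    | 2 =>
      simp only [if_true] at he
      rw [coeff_stdFrame_two, if_neg (by omega)]
    | j + 3 =>
      rw [if_neg (by omega)] at he
      push_cast at he
      rw [coeff_stdFrame_add_three, if_neg (by omega), if_neg (by omega), if_neg (by omega),
        sub_zero, add_zero]

/-! ### Multiplication by `x` and `y` on the frame, and its span. -/

section Relations

variable (lam : ℂ)

theorem coordSeries_zero : coordSeries lam 0 = HahnSeries.single (-3) 1 := rfl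

theorem coordSeries_one : coordSeries lam 1 =
    HahnSeries.single (-4) 1 * (1 - HahnSeries.single 3 (lam ^ 3)) := rfl

theorem single_cube_eq : (HahnSeries.single 3 (lam ^ 3) : LaurentSeries ℂ) =
    HahnSeries.C (lam ^ 3) * HahnSeries.single 3 1 := by
  rw [HahnSeries.C_apply, HahnSeries.single_mul_single, zero_add, mul_one]

theorem single_mul_single_one (a b : ℤ) :
    (HahnSeries.single a 1 * HahnSeries.single b 1 : LaurentSeries ℂ) =
      HahnSeries.single (a + b) 1 := by
  rw [HahnSeries.single_mul_single, one_mul]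

/-- The relations reflect the preimages under `ι`: `z³ = ι(1)`, `f = ι(x - λ³)`, `z⁻¹f = ι(y)`,
`z⁻³f² = ι((x - λ³)²)`, `z⁻⁴f² = ι(y(x - λ³))`, `z⁻⁵f² = ι(y²)`. From there multiplication by `x`
shifts the index by 3. -/
theorem x_mul_stdFrame_zero : coordSeries lam 0 * stdFrame lam 0 =
    stdFrame lam 3 + (lam ^ 3) • stdFrame lam 0 := by
  have h : (HahnSeries.single (-3) 1 * HahnSeries.single 3 1 : LaurentSeries ℂ) = 1 := by
    rw [single_mul_single_one]; rfl
  have h3 : stdFrame lam 3 = HahnSeries.single (-3) 1 * (1 - HahnSeries.single 3 (lam ^ 3)) ^ 2 :=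
    rfl
  rw [coordSeries_zero, h3, stdFrame, ← HahnSeries.C_mul_eq_smul, single_cube_eq]
  linear_combination (HahnSeries.C (lam ^ 3) * (1 - HahnSeries.C (lam ^ 3) *
    HahnSeries.single 3 1)) * h

theorem x_mul_stdFrame_one : coordSeries lam 0 * stdFrame lam 1 =
    stdFrame lam 4 + (lam ^ 3) • stdFrame lam 1 := by
  have h : (HahnSeries.single (-4) 1 * HahnSeries.single 3 1 : LaurentSeries ℂ) =
      HahnSeries.single (-1) 1 := single_mul_single_one _ _
  have h' : (HahnSeries.single (-3) 1 * HahnSeries.single (-1) 1 : LaurentSeries ℂ) =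
      HahnSeries.single (-4) 1 := single_mul_single_one _ _
  have h4 : stdFrame lam 4 = HahnSeries.single (-4) 1 * (1 - HahnSeries.single 3 (lam ^ 3)) ^ 2 :=
    rfl
  rw [coordSeries_zero, h4, stdFrame, ← HahnSeries.C_mul_eq_smul, single_cube_eq]
  linear_combination (HahnSeries.C (lam ^ 3) * (1 - HahnSeries.C (lam ^ 3) *
    HahnSeries.single 3 1)) * h + (1 - HahnSeries.C (lam ^ 3) * HahnSeries.single 3 1) * h'

theorem x_mul_stdFrame_two : coordSeries lam 0 * stdFrame lam 2 =
    stdFrame lam 0 + (lam ^ 3) • stdFrame lam 2 := by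
  have h : (HahnSeries.single (-3) 1 * HahnSeries.single 3 1 : LaurentSeries ℂ) = 1 := by
    rw [single_mul_single_one]; rfl
  rw [coordSeries_zero, stdFrame, stdFrame, ← HahnSeries.C_mul_eq_smul, single_cube_eq]
  linear_combination h

theorem x_mul_stdFrame_add_three (j : ℕ) :
    coordSeries lam 0 * stdFrame lam (j + 3) = stdFrame lam (j + 6) := by
  have h : (HahnSeries.single (-3) 1 * HahnSeries.single (-((j : ℤ) + 3)) 1 : LaurentSeries ℂ) =
      HahnSeries.single (-(((j + 3 : ℕ) : ℤ) + 3)) 1 := by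
    rw [single_mul_single_one, show (-3 : ℤ) + -((j : ℤ) + 3) = -(((j + 3 : ℕ) : ℤ) + 3) by
      push_cast; ring]
  change _ = stdFrame lam ((j + 3) + 3)
  rw [coordSeries_zero, stdFrame, stdFrame, ← h, mul_assoc]

theorem y_mul_stdFrame_zero : coordSeries lam 1 * stdFrame lam 0 = stdFrame lam 4 := by
  change _ = HahnSeries.single (-4) 1 * (1 - HahnSeries.single 3 (lam ^ 3)) ^ 2
  rw [coordSeries_one, stdFrame]
  ring

theorem y_mul_stdFrame_one : coordSeries lam 1 * stdFrame lam 1 = stdFrame lam 5 := by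
  have h : (HahnSeries.single (-4) 1 * HahnSeries.single (-1) 1 : LaurentSeries ℂ) =
      HahnSeries.single (-5) 1 := single_mul_single_one _ _
  change _ = HahnSeries.single (-5) 1 * (1 - HahnSeries.single 3 (lam ^ 3)) ^ 2
  rw [coordSeries_one, stdFrame, ← h]
  ring

theorem y_mul_stdFrame_two : coordSeries lam 1 * stdFrame lam 2 = stdFrame lam 1 := by
  have h : (HahnSeries.single (-4) 1 * HahnSeries.single 3 1 : LaurentSeries ℂ) =
      HahnSeries.single (-1) 1 := single_mul_single_one _ _
  rw [coordSeries_one, stdFrame, stdFrame, ← h]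
  ring

theorem y_mul_stdFrame_add_three (j : ℕ) : coordSeries lam 1 * stdFrame lam (j + 3) =
    stdFrame lam (j + 7) - (lam ^ 3) • stdFrame lam (j + 4) := by
  have h : (HahnSeries.single (-4) 1 * HahnSeries.single (-((j : ℤ) + 3)) 1 : LaurentSeries ℂ) =
      HahnSeries.single (-(((j + 4 : ℕ) : ℤ) + 3)) 1 := by
    rw [single_mul_single_one, show (-4 : ℤ) + -((j : ℤ) + 3) = -(((j + 4 : ℕ) : ℤ) + 3) by
      push_cast; ring]
  have h' : (HahnSeries.single (-(((j + 4 : ℕ) : ℤ) + 3)) 1 * HahnSeries.single 3 1 :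
      LaurentSeries ℂ) = HahnSeries.single (-(((j + 1 : ℕ) : ℤ) + 3)) 1 := by
    rw [single_mul_single_one, show -(((j + 4 : ℕ) : ℤ) + 3) + 3 = -(((j + 1 : ℕ) : ℤ) + 3) by
      push_cast; ring]
  change _ = stdFrame lam ((j + 4) + 3) - (lam ^ 3) • stdFrame lam ((j + 1) + 3)
  rw [coordSeries_one, stdFrame, stdFrame, stdFrame, ← HahnSeries.C_mul_eq_smul, single_cube_eq]
  linear_combination (1 - HahnSeries.C (lam ^ 3) * HahnSeries.single 3 1) ^ 3 * h -
    HahnSeries.C (lam ^ 3) * (1 - HahnSeries.C (lam ^ 3) * HahnSeries.single 3 1) ^ 2 * h'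

theorem coordSeries_mul_stdFrame_mem (i : Fin 2) (j : ℕ) :
    coordSeries lam i * stdFrame lam j ∈ Submodule.span ℂ (Set.range (stdFrame lam)) := by
  have hmem : ∀ k, stdFrame lam k ∈ Submodule.span ℂ (Set.range (stdFrame lam)) := fun k =>
    Submodule.subset_span ⟨k, rfl⟩
  fin_cases i
  · change coordSeries lam 0 * stdFrame lam j ∈ _
    match j with
    | 0 => rw [x_mul_stdFrame_zero]; exact add_mem (hmem _) (Submodule.smul_mem _ _ (hmem _))
    | 1 => rw [x_mul_stdFrame_one]; exact add_mem (hmem _) (Submodule.smul_mem _ _ (hmem _))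
    | 2 => rw [x_mul_stdFrame_two]; exact add_mem (hmem _) (Submodule.smul_mem _ _ (hmem _))
    | j + 3 => rw [x_mul_stdFrame_add_three]; exact hmem _
  · change coordSeries lam 1 * stdFrame lam j ∈ _
    match j with
    | 0 => rw [y_mul_stdFrame_zero]; exact hmem _
    | 1 => rw [y_mul_stdFrame_one]; exact hmem _
    | 2 => rw [y_mul_stdFrame_two]; exact hmem _
    | j + 3 =>
      rw [y_mul_stdFrame_add_three]
      exact sub_mem (hmem _) (Submodule.smul_mem _ _ (hmem _))

theorem iota_mk (p : MvPolynomial (Fin 2) ℂ) :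
    iota lam (Ideal.Quotient.mk (curveIdeal lam) p) = HahnSeries.single 3 1 *
      MvPolynomial.eval₂Hom (HahnSeries.C : ℂ →+* LaurentSeries ℂ) (coordSeries lam) p := rfl

theorem coordSeries_mul_mem_iotaAffineRing (i : Fin 2) {F : LaurentSeries ℂ}
    (hF : F ∈ iotaAffineRing lam) : coordSeries lam i * F ∈ iotaAffineRing lam := by
  obtain ⟨G, rfl⟩ := hF
  obtain ⟨p, rfl⟩ := Ideal.Quotient.mk_surjective G
  refine ⟨Ideal.Quotient.mk (curveIdeal lam) (MvPolynomial.X i * p), ?_⟩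
  rw [iota_mk, iota_mk, map_mul, MvPolynomial.eval₂Hom_X']
  ring

theorem stdFrame_mem_iotaAffineRing (j : ℕ) : stdFrame lam j ∈ iotaAffineRing lam := by
  have h2 : stdFrame lam 2 ∈ iotaAffineRing lam :=
    ⟨Ideal.Quotient.mk (curveIdeal lam) 1, by rw [iota_mk, RingHom.map_one, mul_one]; rfl⟩
  have hx := fun F hF => coordSeries_mul_mem_iotaAffineRing lam 0 (F := F) hF
  have hy := fun F hF => coordSeries_mul_mem_iotaAffineRing lam 1 (F := F) hF
  have h0 : stdFrame lam 0 ∈ iotaAffineRing lam := by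
    rw [eq_sub_iff_add_eq.mpr (x_mul_stdFrame_two lam).symm]
    exact sub_mem (hx _ h2) (Submodule.smul_mem _ _ h2)
  have h1 : stdFrame lam 1 ∈ iotaAffineRing lam := by
    rw [← y_mul_stdFrame_two]
    exact hy _ h2
  induction j using Nat.strong_induction_on with
  | _ j ih =>
    match j with
    | 0 => exact h0
    | 1 => exact h1
    | 2 => exact h2
    | 3 =>
      rw [eq_sub_iff_add_eq.mpr (x_mul_stdFrame_zero lam).symm]
      exact sub_mem (hx _ h0) (Submodule.smul_mem _ _ h0)
    | 4 =>
      rw [← y_mul_stdFrame_zero]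
      exact hy _ h0
    | 5 =>
      rw [← y_mul_stdFrame_one]
      exact hy _ h1
    | j + 6 =>
      rw [← x_mul_stdFrame_add_three]
      exact hx _ (ih _ (by omega))

/-- The span contains `ι(1)` and is stable under `x` and `y`, so induction on polynomials shows that
it contains the whole image. -/
theorem span_stdFrame : Submodule.span ℂ (Set.range (stdFrame lam)) = iotaAffineRing lam := by
  refine le_antisymm (Submodule.span_le.mpr ?_) ?_
  · rintro _ ⟨j, rfl⟩
    exact stdFrame_mem_iotaAffineRing lam j
  · rintro _ ⟨F, rfl⟩
    obtain ⟨p, rfl⟩ := Ideal.Quotient.mk_surjective F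
    rw [iota_mk]
    induction p using MvPolynomial.induction_on with
    | C a =>
      rw [MvPolynomial.eval₂Hom_C, mul_comm, HahnSeries.C_mul_eq_smul]
      exact Submodule.smul_mem _ _ (Submodule.subset_span ⟨2, rfl⟩)
    | add p q hp hq =>
      rw [map_add, mul_add]
      exact add_mem hp hq
    | mul_X p i hp =>
      rw [map_mul, MvPolynomial.eval₂Hom_X', ← mul_assoc, mul_comm]
      refine Submodule.span_induction ?_ ?_ ?_ ?_ hp
      · rintro _ ⟨j, rfl⟩
        exact coordSeries_mul_stdFrame_mem lam i j
      · rw [mul_zero]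
        exact zero_mem _
      · intro F G _ _ hF hG
        rw [mul_add]
        exact add_mem hF hG
      · intro a F _ hF
        rw [← HahnSeries.C_mul_eq_smul, mul_left_comm, HahnSeries.C_mul_eq_smul]
        exact Submodule.smul_mem _ _ hF

theorem isFrame_stdFrame : IsFrame (iotaAffineRing lam) 3 (stdFrame lam) where
  linearIndependent := linearIndependent_stdFrame lam
  span_eq := span_stdFrame lam
  coeff_diag j hj := by
    obtain ⟨j, rfl⟩ := Nat.exists_eq_add_of_le' hj
    rw [coeff_stdFrame_add_three, if_pos (by push_cast; ring), if_neg (by push_cast; omega),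
      if_neg (by push_cast; omega), sub_zero, add_zero]
  coeff_above j hj e he := by
    obtain ⟨j, rfl⟩ := Nat.exists_eq_add_of_le' hj
    push_cast at he
    rw [coeff_stdFrame_add_three, if_neg (by omega), if_neg (by omega), if_neg (by omega),
      sub_zero, add_zero]
  coeff_above_block j hj e he := by
    push_cast at he
    match j with
    | 0 => rw [coeff_stdFrame_zero, if_neg (by omega), if_neg (by omega), sub_zero]
    | 1 => rw [coeff_stdFrame_one, if_neg (by omega), if_neg (by omega), sub_zero]
    | 2 => rw [coeff_stdFrame_two, if_neg (by omega)]

end Relations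

/-! ### Change of frame -/

/-- The finite blocks of the two transition matrices are inverse to each other, which makes the
constant between two τ-functions nonzero. -/
theorem mul_eq_one_of_linearIndependent {V : Type*} [AddCommGroup V] [Module ℂ V] {X Y : ℕ → V}
    (hX : LinearIndependent ℂ X) {A B : ℕ → ℕ → ℂ} {K : ℕ}
    (hA : ∀ j < K, X j = ∑ k ∈ Finset.range K, A j k • Y k)
    (hB : ∀ j < K, Y j = ∑ k ∈ Finset.range K, B j k • X k) :
    (Matrix.of fun j k : Fin K => A j k) * (Matrix.of fun j k : Fin K => B j k) = 1 := by
  ext1 j i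
  have hj : ∑ i ∈ Finset.range K, (∑ k ∈ Finset.range K, A j k * B k i) • X i =
      ∑ i ∈ Finset.range K, (if (j : ℕ) = i then (1 : ℂ) else 0) • X i := by
    have h1 : ∑ i ∈ Finset.range K, (if (j : ℕ) = i then (1 : ℂ) else 0) • X i = X j := by
      simp [ite_smul]
    rw [h1]
    conv_rhs => rw [hA j j.2]
    simp only [Finset.sum_smul]
    rw [Finset.sum_comm]
    refine Finset.sum_congr rfl fun k hk => ?_
    conv_rhs => rw [hB k (Finset.mem_range.mp hk)]
    rw [Finset.smul_sum]
    simp only [mul_smul]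
  have h2 := linearIndependent_iff'ₛ.mp hX _ _ _ hj i (Finset.mem_range.mpr i.2)
  rw [Matrix.mul_apply, Matrix.one_apply]
  simp only [Matrix.of_apply]
  rw [← Finset.sum_range (fun k => A j k * B k i), h2]
  simp only [Fin.ext_iff]

section Change

variable {U : Submodule ℂ (LaurentSeries ℂ)} {l l' : ℕ} {X Y : ℕ → LaurentSeries ℂ}

theorem IsFrame.coeff_neg_eq_zero (hX : IsFrame U l X) {j k : ℕ} (hjk : j < k) (hk : l ≤ k) :
    (X j).coeff (-(k : ℤ)) = 0 := by
  by_cases hl : l ≤ j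
  · exact hX.coeff_above j hl _ (by omega)
  · exact hX.coeff_above_block j (not_le.mp hl) _ (by omega)

theorem IsFrame.exists_change (hX : IsFrame U l X) (hY : IsFrame U l' Y) :
    ∃ A : ℕ → ℕ → ℂ, (∀ k j, max l l' ≤ k → j < k → A j k = 0) ∧
      (∀ j, max l l' ≤ j → A j j = 1) ∧
      ∀ N, max l l' ≤ N → ∀ j < N, X j = ∑ k ∈ Finset.range N, A j k • Y k := by
  have hmem : ∀ j, ∃ c : ℕ →₀ ℂ, (c.sum fun k a => a • Y k) = X j := fun j => by
    rw [← Finsupp.mem_span_range_iff_exists_finsupp, hY.span_eq, ← hX.span_eq]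
    exact Submodule.subset_span ⟨j, rfl⟩
  choose A hA using hmem
  have hcoeff : ∀ j e, (X j).coeff e = ∑ k ∈ (A j).support, A j k * (Y k).coeff e := by
    intro j e
    rw [← hA j, Finsupp.sum, HahnSeries.coeff_sum]
    simp only [HahnSeries.coeff_smul, smul_eq_mul]
  have hz : ∀ k j, max l l' ≤ k → j < k → A j k = 0 := by
    intro k j hk hjk
    by_contra hne
    -- At the largest index `k₀` of the expansion of `X j`, only `Y k₀` has a term in `z^(-k₀)`. If
    -- `k₀ > j` lies beyond both `l` and `l'`, then `X j` has no such term, a contradiction.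
    obtain ⟨k₀, hk₀, hmax⟩ := (A j).support.exists_max_image id
      ⟨k, Finsupp.mem_support_iff.mpr hne⟩
    simp only [id_eq] at hmax
    have hle : k ≤ k₀ := hmax k (Finsupp.mem_support_iff.mpr hne)
    have h := hcoeff j (-(k₀ : ℤ))
    rw [hX.coeff_neg_eq_zero (hjk.trans_le hle) (by omega), Finset.sum_eq_single k₀,
      hY.coeff_diag k₀ (by omega), mul_one] at h
    · exact Finsupp.mem_support_iff.mp hk₀ h.symm
    · intro i hi hik
      rw [hY.coeff_neg_eq_zero (lt_of_le_of_ne (hmax i hi) hik) (by omega), mul_zero]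
    · exact fun h' => absurd hk₀ h'
  have hsub : ∀ N, max l l' ≤ N → ∀ j < N, (A j).support ⊆ Finset.range N := by
    intro N hN j hj k hk
    by_contra hkN
    rw [Finset.mem_range, not_lt] at hkN
    exact Finsupp.mem_support_iff.mp hk (hz k j (hN.trans hkN) (hj.trans_le hkN))
  refine ⟨fun j k => A j k, hz, fun j hj => ?_, fun N hN j hj => ?_⟩
  · have h := hcoeff j (-(j : ℤ))
    rw [Finset.sum_subset (hsub (j + 1) (by omega) j (by omega)), Finset.sum_range_succ,
      Finset.sum_eq_zero, hX.coeff_diag j (by omega), hY.coeff_diag j (by omega), mul_one,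
      zero_add] at h
    · exact h.symm
    · intro k hk
      rw [hY.coeff_neg_eq_zero (Finset.mem_range.mp hk) (by omega), mul_zero]
    · intro k _ hk
      rw [Finsupp.notMem_support_iff.mp hk, zero_mul]
  · rw [← hA j, Finsupp.sum]
    refine Finset.sum_subset (hsub N hN j hj) fun k _ hk => ?_
    rw [Finsupp.notMem_support_iff.mp hk]
    exact zero_smul ℂ (Y k)

/-- The Plücker coordinates of two frames of the same space are proportional. -/
theorem IsFrame.exists_plucker_eq (hX : IsFrame U l X) (hY : IsFrame U l' Y) :
    ∃ c : ℂ, c ≠ 0 ∧ ∀ {n : ℕ} (μ : Nat.Partition n), plucker l X μ = c * plucker l' Y μ := by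
  obtain ⟨A, hA0, hA1, hAX⟩ := hX.exists_change hY
  obtain ⟨B, -, -, hBY⟩ := hY.exists_change hX
  set K := max l l' with hK
  -- For every larger size `N` the transition matrix has this same determinant, so one constant
  -- serves all partitions.
  refine ⟨(Matrix.of fun k j : Fin K => A j k).det, ?_, ?_⟩
  · have hmul : (Matrix.of fun j k : Fin K => A j k) * (Matrix.of fun j k : Fin K => B j k) = 1 := 
      mul_eq_one_of_linearIndependent hX.linearIndependent (hAX K le_rfl)
        (hBY K (max_comm l l').ge)
    have hdet := congrArg Matrix.det hmul
    rw [Matrix.det_mul, Matrix.det_one] at hdet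
    have ht : (Matrix.of fun k j : Fin K => A j k).det =
        (Matrix.of fun j k : Fin K => A j k).det := by
      rw [← Matrix.det_transpose]
      rfl
    rw [ht]
    exact left_ne_zero_of_mul_eq_one hdet
  · intro n μ
    set N := max K μ.parts.card + 1 with hN
    rw [plucker_eq_det hX μ (N := N) (by omega), plucker_eq_det hY μ (N := N) (by omega),
      ← det_eq_det_of_unitriangular (fun k j => A j k) (show K ≤ N by omega)
        (fun k j hk hj => hA0 k j hk hj) (fun j hj => hA1 j hj), mul_comm, ← Matrix.det_mul]
    congr 1
    ext1 i j
    rw [Matrix.mul_apply, Matrix.of_apply, hAX N (by omega) j j.2, HahnSeries.coeff_sum,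
      Finset.sum_range]
    refine Finset.sum_congr rfl fun k _ => ?_
    rw [HahnSeries.coeff_smul, smul_eq_mul, mul_comm]
    rfl

theorem IsFrame.exists_isTau (hX : IsFrame U l X) (hY : IsFrame U l' Y)
    {τ : MvPowerSeries ℕ+ ℂ} (hτ : IsTau l' Y τ) : ∃ c : ℂ, c ≠ 0 ∧ IsTau l X (c • τ) := by
  obtain ⟨c, hc, h⟩ := hX.exists_plucker_eq hY
  refine ⟨c, hc, ?_⟩
  have h1 := hτ.mul_left (MvPowerSeries.C c)
  rw [IsTau, MvPowerSeries.smul_eq_C_mul]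
  refine h1.congr_fun fun p => ?_
  rw [h, ← MvPowerSeries.smul_eq_C_mul, mul_smul]

end Change

end SatoTau

end

theorem mainTheorem5 (lam : ℂ) (hlam : lam ≠ 0) :
    (SatoTau.IsFrame (SatoTau.iotaAffineRing lam) 3 (SatoTau.stdFrame lam) ∧
      SatoTau.IsTau 3 (SatoTau.stdFrame lam) (SatoTau.explicitTau lam)) ∧
    (∀ (l : ℕ) (X : ℕ → LaurentSeries ℂ),
      SatoTau.IsFrame (SatoTau.iotaAffineRing lam) l X →
        ∃ c : ℂ, c ≠ 0 ∧ SatoTau.IsTau l X (c • SatoTau.explicitTau lam)) :=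
  have hframe := SatoTau.isFrame_stdFrame lam
  have htau := SatoTau.isTau_stdFrame hlam hframe
  ⟨⟨hframe, htau⟩, fun _ _ hX => hX.exists_isTau hframe htau⟩
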